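/- **Theorem.** Consider primal positive semidefinite programs $$\text{minimize } C\bullet Y \quad\text{subject to } A_i\bullet Y\ge b_i\ (i=1,\dots,m),\quad Y\succeq 0,$$ where $C,A_1,\dots,A_m$ are real symmetric positive semidefinite $n\times n$ matrices, $b_1,\dots,b_m\ge 0$, and $A\bullet B=\sum_{j,k}A_{jk}B_{jk}$. There are an algorithm $\mathrm{approxPSDP}$ and a constant $c$ such that for all $n\ge 2$, all $m$, every such feasible program and every $\varepsilon>0$, the algorithm, run on $C$, $(A_i)_i$, $(b_i)_i$ and $\varepsilon$, halts with a $(1+\varepsilon)$-approximate solution, that is, a feasible $Y$ whose objective value $C\bullet Y$ is at most $1+\varepsilon$ times the optimal value, after at most $$c\cdot\frac{1}{\varepsilon_0^{4}}\,\log^4 n\,\log\frac1{\varepsilon_0},\qquad \varepsilon_0=\min\{\varepsilon,\tfrac12\},$$ iterations. Each iteration uses only standard primitives on scalars, vectors and matrices, and a special primitive that computes $\exp(\Phi)\bullet A$ for positive semidefinite $\Phi$ and $A$. Here an algorithm is a fixed program, independent of $n$, $m$, $\varepsilon$ and the data, consisting of a preparation, a loop whose rounds are the iterations, and a finish. It works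 in exact real arithmetic on scalars, on $n\times n$ matrices, and on vectors of numbers and families of matrices indexed by the $m$ constraints. Its steps are comparisons of two scalars and the following primitives: scalar arithmetic, $\exp$ and $\log$; entrywise arithmetic and comparison, sum and maximum of vectors; sums, scalar multiples, products, transposes, entrywise products and dot products of matrices; the same linear operations, products with a matrix, sums and dot products for families; and the special primitive. A primitive acts on all $m$ constraints in parallel, and the special primitive may also be applied in parallel to the $n^2$ matrices $(e_j+e_k)(e_j+e_k)^{\mathsf T}$. Each iteration takes at most $c\,(1+\log m/\log n)$ steps (a bounded number if $m\le n^{O(1)}$; $\log m$ is read as $0$ for $m=0$). The preparation and the finish take at most $c$ steps each; only they may also form $M^{-1/2}$ (on the support of $M$) of a positive semidefinite matrix $M$, which serves to normalize the program by $C^{-1/2}$. -/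

import Mathlib

noncomputable section

namespace PSDP

/-! ## Positive semidefinite programs -/

/-- The matrix dot product `A • B = ∑ i j, A i j * B i j`. -/
def dot {n : ℕ} (A B : Matrix (Fin n) (Fin n) ℝ) : ℝ := ∑ i, ∑ j, A i j * B i j

/-- A primal positive SDP: minimize `C • Y` subject to `A i • Y ≥ b i` for all `i` and `Y ≽ 0`,
where `C` and all `A i` are symmetric positive semidefinite and all `b i` are non-negative. -/
structure PositiveSDP (n m : ℕ) where
  C : Matrix (Fin n) (Fin n) ℝ
  A : Fin m → Matrix (Fin n) (Fin n) ℝ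
  b : Fin m → ℝ
  C_psd : C.PosSemidef
  A_psd : ∀ i, (A i).PosSemidef
  b_nonneg : ∀ i, 0 ≤ b i

/-- `Y` satisfies the constraints of the program. -/
def PositiveSDP.IsFeasible {n m : ℕ} (P : PositiveSDP n m) (Y : Matrix (Fin n) (Fin n) ℝ) : Prop :=
  Y.PosSemidef ∧ ∀ i, P.b i ≤ dot (P.A i) Y

/-- `Y` is a `(1 + ε)`-approximation: a feasible solution whose objective value is at most
`1 + ε` times the optimal value `inf {C • Z : Z feasible}`. -/
def PositiveSDP.IsApprox {n m : ℕ} (P : PositiveSDP n m) (ε : ℝ)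
    (Y : Matrix (Fin n) (Fin n) ℝ) : Prop :=
  P.IsFeasible Y ∧ dot P.C Y ≤ (1 + ε) * sInf {v | ∃ Z, P.IsFeasible Z ∧ v = dot P.C Z}

/-! ## The machine

A real-number machine with four banks of registers, each addressed by natural numbers: scalars,
vectors with one real entry per constraint, `n × n` matrices, and families of `n × n` matrices with
one matrix per constraint. A program is a fixed text that does not depend on `n`, `m`, `ε` or the
data. An instruction on a vector or a family acts on all constraints at once (in parallel). -/

/-- The memory of the machine. -/
structure State (n m : ℕ) where
  scal : ℕ → ℝ
  vec : ℕ → Fin m → ℝ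
  mat : ℕ → Matrix (Fin n) (Fin n) ℝ
  fam : ℕ → Fin m → Matrix (Fin n) (Fin n) ℝ

/-- The primitives. The first argument `d` is the register that receives the result. -/
inductive Instr where
  /-- scalar constant -/
  | sConst (d : ℕ) (q : ℚ)
  | sAdd (d a b : ℕ)
  | sSub (d a b : ℕ)
  | sMul (d a b : ℕ)
  | sDiv (d a b : ℕ)
  | sExp (d a : ℕ)
  | sLog (d a : ℕ)
  /-- copy a scalar to all entries of a vector -/
  | vConst (d a : ℕ)
  | vAdd (d v w : ℕ)
  | vSub (d v w : ℕ)
  /-- entrywise product -/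
  | vMul (d v w : ℕ)
  /-- entrywise quotient -/
  | vDiv (d v w : ℕ)
  /-- entrywise comparison: the entry is `1` where `v i ≤ w i` and `0` elsewhere -/
  | vLe (d v w : ℕ)
  /-- the sum of the entries of a vector -/
  | vSum (d v : ℕ)
  /-- the largest entry of a vector (`0` if there are no entries) -/
  | vMax (d v : ℕ)
  /-- identity matrix -/
  | mOne (d : ℕ)
  /-- all-ones matrix -/
  | mOnes (d : ℕ)
  | mAdd (d M N : ℕ)
  /-- scalar times matrix -/
  | mScale (d a M : ℕ)
  | mMul (d M N : ℕ)
  | mTranspose (d M : ℕ)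
  /-- entrywise product of matrices -/
  | mHadamard (d M N : ℕ)
  /-- the scalar `M • N` -/
  | mDot (d M N : ℕ)
  /-- `M ^ (-1/2)` on the support of the positive semidefinite matrix `M` -/
  | mInvSqrt (d M : ℕ)
  | fAdd (d F G : ℕ)
  /-- the family `v i` times `F i` -/
  | fScale (d v F : ℕ)
  /-- the family `M * F i` -/
  | fMulLeft (d M F : ℕ)
  /-- the family `F i * M` -/
  | fMulRight (d F M : ℕ)
  /-- the matrix `∑ i, F i` -/
  | fSum (d F : ℕ)
  /-- the vector `F i • M` -/
  | fDot (d F M : ℕ)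
  /-- the special primitive: the scalar `exp Φ • M` -/
  | expDot (d Φ M : ℕ)
  /-- the special primitive, for all constraints in parallel: the vector `exp Φ • F i` -/
  | expDotFam (d Φ F : ℕ)
  /-- the special primitive, for the rank-one matrices `(e j + e k) (e j + e k)ᵀ` in parallel:
  the `n × n` table of the numbers `exp Φ • (e j + e k) (e j + e k)ᵀ` -/
  | expDotPairs (d Φ : ℕ)

namespace State

variable {n m : ℕ}

def setScal (s : State n m) (d : ℕ) (x : ℝ) : State n m :=
  { s with scal := Function.update s.scal d x }

def setVec (s : State n m) (d : ℕ) (v : Fin m → ℝ) : State n m :=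
  { s with vec := Function.update s.vec d v }

def setMat (s : State n m) (d : ℕ) (M : Matrix (Fin n) (Fin n) ℝ) : State n m :=
  { s with mat := Function.update s.mat d M }

def setFam (s : State n m) (d : ℕ) (F : Fin m → Matrix (Fin n) (Fin n) ℝ) : State n m :=
  { s with fam := Function.update s.fam d F }

end State

/-- The value computed by the special primitive, `exp Φ • A`. -/
def expDotVal {n : ℕ} (Φ A : Matrix (Fin n) (Fin n) ℝ) : ℝ := dot (NormedSpace.exp Φ) A

/-- The positive semidefinite rank-one matrix `(e j + e k) (e j + e k)ᵀ`. -/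
def pairMatrix {n : ℕ} (j k : Fin n) : Matrix (Fin n) (Fin n) ℝ :=
  Matrix.vecMulVec (Pi.single j 1 + Pi.single k 1) (Pi.single j 1 + Pi.single k 1)

/-- When a primitive may be applied: the arguments `Φ`, `A` of the special primitive have to be
positive semidefinite, and so has the argument of the inverse square root. -/
def Instr.Legal {n m : ℕ} (s : State n m) : Instr → Prop
  | .mInvSqrt _ M => (s.mat M).PosSemidef
  | .expDot _ Φ M => (s.mat Φ).PosSemidef ∧ (s.mat M).PosSemidef
  | .expDotFam _ Φ F => (s.mat Φ).PosSemidef ∧ ∀ i, (s.fam F i).PosSemidef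
  | .expDotPairs _ Φ => (s.mat Φ).PosSemidef
  | _ => True

/-- The effect of a primitive on the memory. Division by zero returns zero. -/
def Instr.apply {n m : ℕ} (s : State n m) : Instr → State n m
  | .sConst d q => s.setScal d (q : ℝ)
  | .sAdd d a b => s.setScal d (s.scal a + s.scal b)
  | .sSub d a b => s.setScal d (s.scal a - s.scal b)
  | .sMul d a b => s.setScal d (s.scal a * s.scal b)
  | .sDiv d a b => s.setScal d (s.scal a / s.scal b)
  | .sExp d a => s.setScal d (Real.exp (s.scal a))
  | .sLog d a => s.setScal d (Real.log (s.scal a))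
  | .vConst d a => s.setVec d (fun _ => s.scal a)
  | .vAdd d v w => s.setVec d (fun i => s.vec v i + s.vec w i)
  | .vSub d v w => s.setVec d (fun i => s.vec v i - s.vec w i)
  | .vMul d v w => s.setVec d (fun i => s.vec v i * s.vec w i)
  | .vDiv d v w => s.setVec d (fun i => s.vec v i / s.vec w i)
  | .vLe d v w => s.setVec d (fun i => if s.vec v i ≤ s.vec w i then 1 else 0)
  | .vSum d v => s.setScal d (∑ i, s.vec v i)
  | .vMax d v => s.setScal d (⨆ i, s.vec v i)
  | .mOne d => s.setMat d 1
  | .mOnes d => s.setMat d (Matrix.of fun _ _ => 1)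
  | .mAdd d M N => s.setMat d (s.mat M + s.mat N)
  | .mScale d a M => s.setMat d (s.scal a • s.mat M)
  | .mMul d M N => s.setMat d (s.mat M * s.mat N)
  | .mTranspose d M => s.setMat d (s.mat M).transpose
  | .mHadamard d M N => s.setMat d (Matrix.of fun j k => s.mat M j k * s.mat N j k)
  | .mDot d M N => s.setScal d (dot (s.mat M) (s.mat N))
  | .mInvSqrt d M => s.setMat d (cfc (fun x : ℝ => (Real.sqrt x)⁻¹) (s.mat M))
  | .fAdd d F G => s.setFam d (fun i => s.fam F i + s.fam G i)
  | .fScale d v F => s.setFam d (fun i => s.vec v i • s.fam F i)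
  | .fMulLeft d M F => s.setFam d (fun i => s.mat M * s.fam F i)
  | .fMulRight d F M => s.setFam d (fun i => s.fam F i * s.mat M)
  | .fSum d F => s.setMat d (∑ i, s.fam F i)
  | .fDot d F M => s.setVec d (fun i => dot (s.fam F i) (s.mat M))
  | .expDot d Φ M => s.setScal d (expDotVal (s.mat Φ) (s.mat M))
  | .expDotFam d Φ F => s.setVec d (fun i => expDotVal (s.mat Φ) (s.fam F i))
  | .expDotPairs d Φ => s.setMat d (Matrix.of fun j k => expDotVal (s.mat Φ) (pairMatrix j k))

/-- A test compares two scalar registers: `scal lhs ≤ scal rhs`. -/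
structure Test where
  lhs : ℕ
  rhs : ℕ

def Test.Holds {n m : ℕ} (t : Test) (s : State n m) : Prop := s.scal t.lhs ≤ s.scal t.rhs

/-- Programs: primitives, the empty program, composition, branching and loops. -/
inductive Prog where
  | prim (i : Instr)
  | skip
  | seq (p q : Prog)
  | cond (t : Test) (p q : Prog)
  | loop (t : Test) (p : Prog)

/-- `Exec p s k s'`: started in memory `s`, the program `p` halts in memory `s'` after `k` steps.
Each primitive and each evaluation of a test is one step. An illegal primitive blocks. -/
inductive Exec {n m : ℕ} : Prog → State n m → ℕ → State n m → Prop where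
  | prim (i : Instr) (s : State n m) (h : i.Legal s) : Exec (.prim i) s 1 (i.apply s)
  | skip (s : State n m) : Exec .skip s 0 s
  | seq {p q : Prog} {s s' s'' : State n m} {k l : ℕ} (hp : Exec p s k s') (hq : Exec q s' l s'') :
      Exec (.seq p q) s (k + l) s''
  | condTrue {t : Test} {p q : Prog} {s s' : State n m} {k : ℕ} (ht : t.Holds s)
      (hp : Exec p s k s') : Exec (.cond t p q) s (k + 1) s'
  | condFalse {t : Test} {p q : Prog} {s s' : State n m} {k : ℕ} (ht : ¬ t.Holds s)
      (hq : Exec q s k s') : Exec (.cond t p q) s (k + 1) s'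
  | loopTrue {t : Test} {p : Prog} {s s' s'' : State n m} {k l : ℕ} (ht : t.Holds s)
      (hp : Exec p s k s') (hl : Exec (.loop t p) s' l s'') : Exec (.loop t p) s (k + l + 1) s''
  | loopFalse {t : Test} {p : Prog} {s : State n m} (ht : ¬ t.Holds s) : Exec (.loop t p) s 1 s

/-- The program does not contain the inverse square root (which is for normalizing the SDP only). -/
def Prog.NoInvSqrt : Prog → Prop
  | .prim (.mInvSqrt _ _) => False
  | .prim _ => True
  | .skip => True
  | .seq p q => p.NoInvSqrt ∧ q.NoInvSqrt
  | .cond _ p q => p.NoInvSqrt ∧ q.NoInvSqrt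
  | .loop _ p => p.NoInvSqrt

/-- An iterative algorithm: a preparation, then iterations of `body` as long as `guard` holds, then
a finish. The iterations use only ordinary arithmetic on scalars, vectors and matrices and the
special primitive `exp Φ • A`. -/
structure Algorithm where
  prep : Prog
  guard : Test
  body : Prog
  finish : Prog
  body_ok : body.NoInvSqrt

/-- The memory at the start, on input `P` and `ε`: the scalar registers `0, 1, 2` hold `ε, n, m`,
the vector register `0` holds `b`, the matrix register `0` holds `C`, the family register `0`
holds the constraint matrices, and everything else is zero. -/
def initialState {n m : ℕ} (P : PositiveSDP n m) (ε : ℝ) : State n m where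
  scal := fun r => if r = 0 then ε else if r = 1 then (n : ℝ) else if r = 2 then (m : ℝ) else 0
  vec := fun r => if r = 0 then P.b else 0
  mat := fun r => if r = 0 then P.C else 0
  fam := fun r => if r = 0 then P.A else 0

/-- On input `P` and `ε` the algorithm halts after exactly `T` iterations with `Y` in the matrix
register `0`; every iteration takes at most `perIter` steps, and the preparation and the finish
take at most `overhead` steps each. -/
def Algorithm.Computes (alg : Algorithm) {n m : ℕ} (P : PositiveSDP n m) (ε : ℝ) (T : ℕ)
    (perIter overhead : ℝ) (Y : Matrix (Fin n) (Fin n) ℝ) : Prop :=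
  ∃ (σ : ℕ → State n m) (final : State n m),
    (∃ k : ℕ, (k : ℝ) ≤ overhead ∧ Exec alg.prep (initialState P ε) k (σ 0)) ∧
    (∀ t < T, alg.guard.Holds (σ t) ∧
      ∃ k : ℕ, (k : ℝ) ≤ perIter ∧ Exec alg.body (σ t) k (σ (t + 1))) ∧
    ¬ alg.guard.Holds (σ T) ∧
    (∃ k : ℕ, (k : ℝ) ≤ overhead ∧ Exec alg.finish (σ T) k final) ∧
    final.mat 0 = Y

end PSDP

end

/-! Conjugation by `C^{-1/2}` turns the program into: minimize `tr Y` subject to `F i • Y ≥ 1`, with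
`F i = C^{-1/2} A i C^{-1/2} / b i`. Constraints that the kernel of `C` can satisfy are dropped,
because a multiple of the kernel projection satisfies them at cost zero.

The normalized program is solved by matrix multiplicative weights. With dual weights `x`, put `Φ = ∑
x i F i` and `W = exp Φ`. For a guess `μ` of the optimum, every weight with `μ (F i • W) ≤ (1 + δ)
tr W` is multiplied by `1 + α`. The trace bound `trace_exp_add_le` then keeps `log tr W ≤ log n + 1
+ (1 + 3δ) (∑ x i) / μ` (`potential_step`). Since `Φ ≤ (log tr W) I`, the vector `x / log tr W` is
dual feasible. Hence `μ log tr W ≤ (1 + 4δ) ∑ x i` certifies that the optimum is at least `μ / (1 +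
4δ)` (`Stop.trace_le`).

The primal solution comes from the sum of the density matrices `W / tr W` of a phase. Once this sum,
scaled to cover all constraints, has trace at most `μ`, it is recorded and `μ` is divided by `1 +
δ`. A constraint not updated in a round gains at least `1 + δ` in `μ F i • acc`, and each constraint
is updated boundedly often because `Φ` stays bounded before stopping. So the gains win and every
phase is short (`Inv.step`). The guesses range over a factor of about `n`, which bounds the number
of phases (`Inv.progress_le`).

The total is of order `δ⁻⁴ log³ n log (1/δ) (1 + log m / log n)` steps. Performing `⌊log m / log n⌋
+ 1` steps per iteration removes the dependence on `m`. The special primitive on the pair matrices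
yields all of `W` (`recover_from_pairs`), so a step is a bounded straight-line computation with two
branches. -/

namespace PSDP

open Matrix

/-! ### Spectral calculus and trace inequalities for the matrix exponential -/

section MatrixAnalysis

variable {n : ℕ}

theorem dot_eq_trace (A B : Matrix (Fin n) (Fin n) ℝ) : dot A B = (Aᵀ * B).trace := by
  simp only [dot, Matrix.trace, Matrix.diag, Matrix.mul_apply, Matrix.transpose_apply]
  exact Finset.sum_comm

theorem dot_comm (A B : Matrix (Fin n) (Fin n) ℝ) : dot A B = dot B A := by
  simp only [dot, mul_comm]

theorem dot_add_right (A B C : Matrix (Fin n) (Fin n) ℝ) : dot A (B + C) = dot A B + dot A C := by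
  simp only [dot, Matrix.add_apply, mul_add, Finset.sum_add_distrib]

theorem dot_sub_right (A B C : Matrix (Fin n) (Fin n) ℝ) : dot A (B - C) = dot A B - dot A C := by
  simp only [dot, Matrix.sub_apply, mul_sub, Finset.sum_sub_distrib]

theorem dot_smul_right (A B : Matrix (Fin n) (Fin n) ℝ) (r : ℝ) : dot A (r • B) = r * dot A B := by
  simp only [dot, Matrix.smul_apply, smul_eq_mul, Finset.mul_sum]
  exact Finset.sum_congr rfl fun i _ => Finset.sum_congr rfl fun j _ => by ring

theorem dot_sum_right {ι : Type*} (s : Finset ι) (A : Matrix (Fin n) (Fin n) ℝ)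
    (F : ι → Matrix (Fin n) (Fin n) ℝ) : dot A (∑ i ∈ s, F i) = ∑ i ∈ s, dot A (F i) := by
  simp only [dot_eq_trace, Matrix.mul_sum, Matrix.trace_sum]

theorem dot_smul_left (A B : Matrix (Fin n) (Fin n) ℝ) (r : ℝ) : dot (r • A) B = r * dot A B := by
  rw [dot_comm, dot_smul_right, dot_comm]

theorem dot_sub_left (A B C : Matrix (Fin n) (Fin n) ℝ) : dot (A - B) C = dot A C - dot B C := by
  rw [dot_comm, dot_sub_right, dot_comm C, dot_comm C]

@[simp] theorem dot_zero_left (A : Matrix (Fin n) (Fin n) ℝ) : dot 0 A = 0 := by simp [dot]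

@[simp] theorem dot_zero_right (A : Matrix (Fin n) (Fin n) ℝ) : dot A 0 = 0 := by simp [dot]

theorem dot_one_right (A : Matrix (Fin n) (Fin n) ℝ) : dot A 1 = A.trace := by
  simp [dot_eq_trace]

theorem transpose_eq_of_isHermitian {A : Matrix (Fin n) (Fin n) ℝ} (hA : A.IsHermitian) :
    Aᵀ = A := by
  simpa [Matrix.IsHermitian, Matrix.conjTranspose_eq_transpose_of_trivial] using hA

theorem dot_conj {H : Matrix (Fin n) (Fin n) ℝ} (hH : Hᵀ = H) (A B : Matrix (Fin n) (Fin n) ℝ) :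
    dot (H * A * H) B = dot A (H * B * H) := by
  simp only [dot_eq_trace, Matrix.transpose_mul, hH]
  rw [Matrix.mul_assoc H, Matrix.mul_assoc H, Matrix.trace_mul_comm]
  simp only [Matrix.mul_assoc]

/-- The symmetric matrix with orthogonal eigenvector matrix `U` and eigenvalues `a`. -/
def spectralMatrix (U : Matrix (Fin n) (Fin n) ℝ) (a : Fin n → ℝ) : Matrix (Fin n) (Fin n) ℝ :=
  U * diagonal a * Uᵀ

section Spectral

variable {U V : Matrix (Fin n) (Fin n) ℝ}

theorem spectralMatrix_transpose (a : Fin n → ℝ) :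
    (spectralMatrix U a)ᵀ = spectralMatrix U a := by
  simp [spectralMatrix, Matrix.mul_assoc]

theorem spectralMatrix_one (hU : U * Uᵀ = 1) : spectralMatrix U 1 = 1 := by
  simp only [spectralMatrix, Pi.one_def, Matrix.diagonal_one, Matrix.mul_one, hU]

theorem spectralMatrix_mul (hU : U * Uᵀ = 1) (a b : Fin n → ℝ) :
    spectralMatrix U a * spectralMatrix U b = spectralMatrix U (a * b) := by
  have hU' : Uᵀ * U = 1 := mul_eq_one_comm.mp hU
  calc U * diagonal a * Uᵀ * (U * diagonal b * Uᵀ)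
      = U * diagonal a * (Uᵀ * U) * diagonal b * Uᵀ := by simp only [Matrix.mul_assoc]
    _ = U * (diagonal a * diagonal b) * Uᵀ := by
      rw [hU']; simp only [Matrix.mul_assoc, Matrix.one_mul]
    _ = _ := by rw [Matrix.diagonal_mul_diagonal]; rfl

theorem smul_one_sub_spectralMatrix (hU : U * Uᵀ = 1) (c : ℝ) (a : Fin n → ℝ) :
    c • 1 - spectralMatrix U a = spectralMatrix U (fun i => c - a i) := by
  have h : (fun i => c - a i) = c • (1 : Fin n → ℝ) - a := by ext i; simp
  have h' : diagonal (c • (1 : Fin n → ℝ) - a)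
      = c • (1 : Matrix (Fin n) (Fin n) ℝ) - diagonal a := by
    rw [← Matrix.diagonal_one, ← Matrix.diagonal_smul, Matrix.diagonal_sub]
    rfl
  simp only [spectralMatrix, h, h', Matrix.mul_sub, Matrix.sub_mul, Matrix.mul_smul,
    Matrix.smul_mul, Matrix.mul_one, hU]

theorem posSemidef_spectralMatrix {a : Fin n → ℝ} (ha : 0 ≤ a) :
    (spectralMatrix U a).PosSemidef := by
  have := (PosSemidef.diagonal ha).mul_mul_conjTranspose_same U
  simpa [spectralMatrix, Matrix.conjTranspose_eq_transpose_of_trivial] using this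

theorem exp_spectralMatrix (hU : U * Uᵀ = 1) (a : Fin n → ℝ) :
    NormedSpace.exp (spectralMatrix U a) = spectralMatrix U (fun i => Real.exp (a i)) := by
  have hinv : U⁻¹ = Uᵀ := Matrix.inv_eq_right_inv hU
  have hunit : IsUnit U := IsUnit.of_mul_eq_one _ hU
  rw [spectralMatrix, ← hinv, Matrix.exp_conj _ _ hunit, Matrix.exp_diagonal, hinv,
    spectralMatrix]
  congr 3
  ext i
  rw [Pi.coe_exp, Real.exp_eq_exp_ℝ]

theorem exists_spectralMatrix {A : Matrix (Fin n) (Fin n) ℝ} (hA : A.IsHermitian) :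
    ∃ U : Matrix (Fin n) (Fin n) ℝ, U * Uᵀ = 1 ∧ A = spectralMatrix U hA.eigenvalues ∧
      ∀ f : ℝ → ℝ, cfc f A = spectralMatrix U (f ∘ hA.eigenvalues) := by
  refine ⟨hA.eigenvectorUnitary, ?_, ?_, fun f => ?_⟩
  · have := Unitary.coe_mul_star_self hA.eigenvectorUnitary
    simpa [Matrix.star_eq_conjTranspose, Matrix.conjTranspose_eq_transpose_of_trivial] using this
  · conv_lhs => rw [hA.spectral_theorem]
    simp [spectralMatrix, Unitary.conjStarAlgAut_apply, Matrix.star_eq_conjTranspose,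
      Matrix.conjTranspose_eq_transpose_of_trivial]
  · rw [hA.cfc_eq]
    simp [Matrix.IsHermitian.cfc, spectralMatrix, Unitary.conjStarAlgAut_apply,
      Matrix.star_eq_conjTranspose, Matrix.conjTranspose_eq_transpose_of_trivial,
      Function.comp_def]

/-- The squared overlaps of two eigenbases act as nonnegative weights. Trace inequalities for two
noncommuting matrices thereby reduce to scalar inequalities between their eigenvalues. -/
theorem dot_spectralMatrix (a b : Fin n → ℝ) :
    dot (spectralMatrix U a) (spectralMatrix V b)
      = ∑ i, ∑ j, (Uᵀ * V) i j ^ 2 * (a i * b j) := by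
  rw [dot_eq_trace, spectralMatrix_transpose]
  have : (spectralMatrix U a * spectralMatrix V b).trace
      = (diagonal a * (Uᵀ * V) * diagonal b * (Uᵀ * V)ᵀ).trace := by
    rw [spectralMatrix, Matrix.mul_assoc U, Matrix.mul_assoc U, Matrix.trace_mul_comm]
    simp only [spectralMatrix, Matrix.transpose_mul, Matrix.transpose_transpose, Matrix.mul_assoc]
  rw [this]
  simp only [Matrix.trace, Matrix.diag, Matrix.mul_apply (M := diagonal a * (Uᵀ * V) * diagonal b),
    Matrix.mul_diagonal, Matrix.diagonal_mul, Matrix.transpose_apply]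
  exact Finset.sum_congr rfl fun i _ => Finset.sum_congr rfl fun j _ => by ring

end Spectral

theorem posSemidef_exp {Φ : Matrix (Fin n) (Fin n) ℝ} (hΦ : Φ.IsHermitian) :
    (NormedSpace.exp Φ).PosSemidef := by
  obtain ⟨U, hU, hA, -⟩ := exists_spectralMatrix hΦ
  rw [hA, exp_spectralMatrix hU]
  exact posSemidef_spectralMatrix fun i => (Real.exp_pos _).le

theorem dot_nonneg {A B : Matrix (Fin n) (Fin n) ℝ} (hA : A.PosSemidef) (hB : B.PosSemidef) :
    0 ≤ dot A B := by
  obtain ⟨U, hU, h1, -⟩ := exists_spectralMatrix hA.1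
  obtain ⟨V, hV, h2, -⟩ := exists_spectralMatrix hB.1
  rw [h1, h2, dot_spectralMatrix]
  exact Finset.sum_nonneg fun i _ => Finset.sum_nonneg fun j _ =>
    mul_nonneg (sq_nonneg _) (mul_nonneg (hA.eigenvalues_nonneg i) (hB.eigenvalues_nonneg j))

/-- The upper bound of the Klein type for the trace exponential under a small positive
semidefinite perturbation. -/
theorem trace_exp_add_le {Φ Δ : Matrix (Fin n) (Fin n) ℝ} (hΦ : Φ.IsHermitian)
    (hΔ : Δ.PosSemidef) {l : ℝ} (hl0 : 0 < l) (hl1 : l < 1) (hl : (l • 1 - Δ).PosSemidef) :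
    (NormedSpace.exp (Φ + Δ)).trace
      ≤ (NormedSpace.exp Φ).trace + (1 + l) / (1 - l) * dot (NormedSpace.exp Φ) Δ := by
  have hΦ' : (Φ + Δ).IsHermitian := hΦ.add hΔ.1
  have hE := posSemidef_exp hΦ
  have hE' := posSemidef_exp hΦ'
  -- This is `Δ² ≤ l Δ`, from the identity `l x (l - x) = x (l - x) x + (l - x) x (l - x)`.
  have hsq : (l • Δ - Δ * Δ).PosSemidef := by
    have h1 : (Δ * (l • 1 - Δ) * Δ).PosSemidef := by
      have := hl.mul_mul_conjTranspose_same Δ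
      rwa [hΔ.1.eq] at this
    have h2 : ((l • 1 - Δ) * Δ * (l • 1 - Δ)).PosSemidef := by
      have := hΔ.mul_mul_conjTranspose_same (l • 1 - Δ)
      rwa [hl.1.eq] at this
    have h3 : l • Δ - Δ * Δ
        = l⁻¹ • (Δ * (l • 1 - Δ) * Δ + (l • 1 - Δ) * Δ * (l • 1 - Δ)) := by
      rw [eq_inv_smul_iff₀ hl0.ne']
      simp only [mul_sub, sub_mul, smul_mul_assoc, mul_smul_comm, one_mul, mul_one, smul_sub]
      abel
    rw [h3]
    exact (h1.add h2).smul (inv_nonneg.mpr hl0.le)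
  obtain ⟨U, hU, h1, -⟩ := exists_spectralMatrix hΦ
  obtain ⟨V, hV, h2, -⟩ := exists_spectralMatrix hΦ'
  set a := hΦ.eigenvalues
  set b := hΦ'.eigenvalues
  set E := NormedSpace.exp Φ with hEdef
  set E' := NormedSpace.exp (Φ + Δ) with hEdef'
  set Φ' := Φ + Δ with hΦdef
  have hΔeq : Δ = Φ' - Φ := by rw [hΦdef]; abel
  have eE : E = spectralMatrix U (fun i => Real.exp (a i)) := by
    rw [hEdef, h1, exp_spectralMatrix hU]
  have eE' : E' = spectralMatrix V (fun i => Real.exp (b i)) := by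
    rw [hEdef', h2, exp_spectralMatrix hV]
  -- Every trace below becomes a sum over pairs (eigenvalue `a i` of `Φ`, eigenvalue `b j` of `Φ +
  -- Δ`) with these weights. In the mixed bases `Δ` acts as `b j - a i`.
  let p : Fin n → Fin n → ℝ := fun i j => (Uᵀ * V) i j ^ 2
  have hp : ∀ i j, 0 ≤ p i j := fun i j => sq_nonneg _
  have key : ∀ f g : Fin n → ℝ, dot (spectralMatrix U f) (spectralMatrix V g)
      = ∑ i, ∑ j, p i j * (f i * g j) := fun f g => dot_spectralMatrix f g
  have mulL : ∀ f g : Fin n → ℝ, spectralMatrix U f * spectralMatrix U g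
    = spectralMatrix U (f * g) := spectralMatrix_mul hU
  have mulR : ∀ f g : Fin n → ℝ, spectralMatrix V f * spectralMatrix V g
    = spectralMatrix V (f * g) := spectralMatrix_mul hV
  have oneU := spectralMatrix_one hU
  have oneV := spectralMatrix_one hV
  have tU : ∀ f : Fin n → ℝ, (spectralMatrix U f).trace = ∑ i, ∑ j, p i j * (f i * 1) := by
    intro f
    rw [← dot_one_right, ← oneV, key]
    rfl
  have tV : ∀ f : Fin n → ℝ, (spectralMatrix V f).trace = ∑ i, ∑ j, p i j * (1 * f j) := by
    intro f
    rw [← dot_one_right, dot_comm, ← oneU, key]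
    rfl
  have dUU : ∀ f g : Fin n → ℝ, dot (spectralMatrix U f) (spectralMatrix U g)
      = ∑ i, ∑ j, p i j * (f i * g i * 1) := by
    intro f g
    rw [dot_eq_trace, spectralMatrix_transpose, mulL, tU]
    rfl
  have dVV : ∀ f g : Fin n → ℝ, dot (spectralMatrix V f) (spectralMatrix V g)
      = ∑ i, ∑ j, p i j * (1 * (f j * g j)) := by
    intro f g
    rw [dot_eq_trace, spectralMatrix_transpose, mulR, tV]
    rfl
  have trE : E.trace = ∑ i, ∑ j, p i j * Real.exp (a i) := by
    rw [eE, tU]; simp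
  have trE' : E'.trace = ∑ i, ∑ j, p i j * Real.exp (b j) := by
    rw [eE', tV]; simp
  have dE : dot E Δ = ∑ i, ∑ j, p i j * (Real.exp (a i) * (b j - a i)) := by
    rw [hΔeq, dot_sub_right, eE, h1, h2, key, dUU]
    simp only [← Finset.sum_sub_distrib]
    exact Finset.sum_congr rfl fun i _ => Finset.sum_congr rfl fun j _ => by ring
  have dE' : dot E' Δ = ∑ i, ∑ j, p i j * (Real.exp (b j) * (b j - a i)) := by
    rw [hΔeq, dot_sub_right, eE', h1, h2, dVV, dot_comm, key]
    simp only [← Finset.sum_sub_distrib]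
    exact Finset.sum_congr rfl fun i _ => Finset.sum_congr rfl fun j _ => by ring
  have hexp : Δ * Δ = Φ' * Φ' - Φ * Φ' - Φ' * Φ + Φ * Φ := by
    rw [hΔeq]; simp only [mul_sub, sub_mul]; abel
  have dE2 : dot E (Δ * Δ) = ∑ i, ∑ j, p i j * (Real.exp (a i) * (b j - a i) ^ 2) := by
    have c1 : dot (spectralMatrix U fun i => Real.exp (a i))
        (spectralMatrix U a * spectralMatrix V b)
        = ∑ i, ∑ j, p i j * (Real.exp (a i) * a i * b j) := by
      rw [dot_eq_trace, spectralMatrix_transpose, ← mul_assoc, mulL,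
        ← spectralMatrix_transpose, ← dot_eq_trace, key]
      rfl
    have c2 : dot (spectralMatrix U fun i => Real.exp (a i))
        (spectralMatrix V b * spectralMatrix U a)
        = ∑ i, ∑ j, p i j * (a i * Real.exp (a i) * b j) := by
      rw [dot_eq_trace, spectralMatrix_transpose, Matrix.trace_mul_comm, mul_assoc, mulL,
        Matrix.trace_mul_comm, ← spectralMatrix_transpose, ← dot_eq_trace, key]
      rfl
    rw [hexp, dot_add_right, dot_sub_right, dot_sub_right, eE, h1, h2, mulL, mulR, key, dUU,
      c1, c2]
    simp only [← Finset.sum_sub_distrib, ← Finset.sum_add_distrib, Pi.mul_apply]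
    exact Finset.sum_congr rfl fun i _ => Finset.sum_congr rfl fun j _ => by ring
  have dE2' : dot E' (Δ * Δ) = ∑ i, ∑ j, p i j * (Real.exp (b j) * (b j - a i) ^ 2) := by
    have c1 : dot (spectralMatrix V fun i => Real.exp (b i))
        (spectralMatrix V b * spectralMatrix U a)
        = ∑ i, ∑ j, p i j * (a i * (Real.exp (b j) * b j)) := by
      rw [dot_eq_trace, spectralMatrix_transpose, ← mul_assoc, mulR,
        ← spectralMatrix_transpose, ← dot_eq_trace, dot_comm, key]
      rfl
    have c2 : dot (spectralMatrix V fun i => Real.exp (b i))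
        (spectralMatrix U a * spectralMatrix V b)
        = ∑ i, ∑ j, p i j * (a i * (b j * Real.exp (b j))) := by
      rw [dot_eq_trace, spectralMatrix_transpose, Matrix.trace_mul_comm, mul_assoc, mulR,
        ← spectralMatrix_transpose, ← dot_eq_trace, key]
      rfl
    rw [hexp, dot_add_right, dot_sub_right, dot_sub_right, eE', h1, h2, mulL, mulR, dVV,
      dot_comm _ (spectralMatrix U _), key, c1, c2]
    simp only [← Finset.sum_sub_distrib, ← Finset.sum_add_distrib, Pi.mul_apply]
    exact Finset.sum_congr rfl fun i _ => Finset.sum_congr rfl fun j _ => by ring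
  have bE2 : dot E (Δ * Δ) ≤ l * dot E Δ := by
    have := dot_nonneg hE hsq
    rw [dot_sub_right, dot_smul_right] at this
    linarith
  have bE2' : dot E' (Δ * Δ) ≤ l * dot E' Δ := by
    have := dot_nonneg hE' hsq
    rw [dot_sub_right, dot_smul_right] at this
    linarith
  -- Convexity of the exponential, pair by pair: `e^b - e^a ≤ e^b (b - a)`.
  have klein : E'.trace - E.trace ≤ dot E' Δ := by
    rw [trE, trE', dE']
    simp only [← Finset.sum_sub_distrib]
    refine Finset.sum_le_sum fun i _ => Finset.sum_le_sum fun j _ => ?_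
    rw [← mul_sub]
    refine mul_le_mul_of_nonneg_left ?_ (hp i j)
    have h := Real.add_one_le_exp (a i - b j)
    have h' : Real.exp (a i) = Real.exp (b j) * Real.exp (a i - b j) := by
      rw [← Real.exp_add]; congr 1; ring
    rw [h']
    nlinarith [Real.exp_pos (b j)]
  -- Pair by pair, `(e^b - e^a) (b - a) ≤ (e^a + e^b) (b - a)²`. With `Δ² ≤ l Δ` this trades `exp (Φ
  -- + Δ)` for `exp Φ` at the price of the factor `(1 + l) / (1 - l)`.
  have diff : dot E' Δ - dot E Δ ≤ dot E (Δ * Δ) + dot E' (Δ * Δ) := by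
    rw [dE, dE', dE2, dE2']
    simp only [← Finset.sum_sub_distrib, ← Finset.sum_add_distrib]
    refine Finset.sum_le_sum fun i _ => Finset.sum_le_sum fun j _ => ?_
    rw [← mul_sub, ← mul_add]
    refine mul_le_mul_of_nonneg_left ?_ (hp i j)
    have h1 := Real.add_one_le_exp (a i - b j)
    have h2 := Real.add_one_le_exp (b j - a i)
    have h1' : Real.exp (a i) = Real.exp (b j) * Real.exp (a i - b j) := by
      rw [← Real.exp_add]; congr 1; ring
    have h2' : Real.exp (b j) = Real.exp (a i) * Real.exp (b j - a i) := by
      rw [← Real.exp_add]; congr 1; ring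
    have pa := Real.exp_pos (a i)
    have pb := Real.exp_pos (b j)
    have k1 : Real.exp (b j) * (a i - b j + 1) ≤ Real.exp (a i) := by
      rw [h1']; exact mul_le_mul_of_nonneg_left h1 pb.le
    have k2 : Real.exp (a i) * (b j - a i + 1) ≤ Real.exp (b j) := by
      rw [h2']; exact mul_le_mul_of_nonneg_left h2 pa.le
    rcases le_total (a i) (b j) with hab | hab
    · have := mul_le_mul_of_nonneg_right k1 (sub_nonneg.mpr hab)
      have := mul_nonneg pa.le (sq_nonneg (b j - a i))
      nlinarith
    · have := mul_le_mul_of_nonneg_right k2 (sub_nonneg.mpr hab)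
      have := mul_nonneg pb.le (sq_nonneg (b j - a i))
      nlinarith
  have hlast : dot E' Δ ≤ (1 + l) / (1 - l) * dot E Δ := by
    rw [div_mul_eq_mul_div, le_div_iff₀ (by linarith)]
    linarith
  linarith

/-- A symmetric matrix is bounded by the logarithm of the trace of its exponential. -/
theorem posSemidef_log_trace_exp_sub {Φ : Matrix (Fin n) (Fin n) ℝ} (hΦ : Φ.IsHermitian) :
    (Real.log (NormedSpace.exp Φ).trace • 1 - Φ).PosSemidef := by
  obtain ⟨U, hU, h1, -⟩ := exists_spectralMatrix hΦ
  set a := hΦ.eigenvalues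
  have tr : (NormedSpace.exp Φ).trace = ∑ i, Real.exp (a i) := by
    rw [h1, exp_spectralMatrix hU, spectralMatrix, Matrix.trace_mul_comm, ← mul_assoc,
      mul_eq_one_comm.mp hU, one_mul, Matrix.trace_diagonal]
  set ℓ := Real.log (NormedSpace.exp Φ).trace with hℓ
  have : ℓ • 1 - Φ = spectralMatrix U (fun i => ℓ - a i) := by
    conv_lhs => rw [h1]
    exact smul_one_sub_spectralMatrix hU ℓ a
  rw [this]
  refine posSemidef_spectralMatrix fun i => ?_
  simp only [Pi.zero_apply, sub_nonneg]
  rw [hℓ, tr, Real.le_log_iff_exp_le]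
  · exact Finset.single_le_sum (f := fun i => Real.exp (a i)) (fun i _ => (Real.exp_pos _).le)
      (Finset.mem_univ i)
  · exact Finset.sum_pos (fun i _ => Real.exp_pos _) ⟨i, Finset.mem_univ i⟩

theorem le_trace_exp {Φ : Matrix (Fin n) (Fin n) ℝ} (hΦ : Φ.PosSemidef) :
    (n : ℝ) ≤ (NormedSpace.exp Φ).trace := by
  obtain ⟨U, hU, h1, -⟩ := exists_spectralMatrix hΦ.1
  rw [h1, exp_spectralMatrix hU, spectralMatrix, Matrix.trace_mul_comm, ← mul_assoc,
      mul_eq_one_comm.mp hU, one_mul, Matrix.trace_diagonal]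
  calc (n : ℝ) = ∑ _i : Fin n, (1 : ℝ) := by simp
    _ ≤ _ := Finset.sum_le_sum fun i _ => Real.one_le_exp (hΦ.eigenvalues_nonneg i)

theorem trace_exp_le {Φ : Matrix (Fin n) (Fin n) ℝ} (hΦ : Φ.PosSemidef) (htr : Φ.trace ≤ 1) :
    (NormedSpace.exp Φ).trace ≤ n * Real.exp 1 := by
  obtain ⟨U, hU, h1, -⟩ := exists_spectralMatrix hΦ.1
  have h0 : Φ.trace = ∑ i, hΦ.1.eigenvalues i := by simpa using hΦ.1.trace_eq_sum_eigenvalues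
  rw [h1, exp_spectralMatrix hU, spectralMatrix, Matrix.trace_mul_comm, ← mul_assoc,
      mul_eq_one_comm.mp hU, one_mul, Matrix.trace_diagonal]
  calc _ ≤ ∑ _i : Fin n, Real.exp 1 := Finset.sum_le_sum fun i _ => Real.exp_le_exp.mpr ?_
    _ = _ := by simp
  exact (Finset.single_le_sum (f := hΦ.1.eigenvalues)
    (fun j _ => hΦ.eigenvalues_nonneg j) (Finset.mem_univ i)).trans (h0 ▸ htr)

/-- Holds because `exp Φ ≥ 1`. It guarantees that a sum of density matrices can be scaled to cover
every nonzero constraint. -/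
theorem dot_exp_pos {Φ A : Matrix (Fin n) (Fin n) ℝ} (hΦ : Φ.PosSemidef) (hA : A.PosSemidef)
    (hA0 : A ≠ 0) : 0 < dot (NormedSpace.exp Φ) A := by
  have h : (NormedSpace.exp Φ - 1).PosSemidef := by
    obtain ⟨U, hU, h1, -⟩ := exists_spectralMatrix hΦ.1
    have : NormedSpace.exp Φ - 1
        = spectralMatrix U (fun i => Real.exp (hΦ.1.eigenvalues i) - 1) := by
      conv_lhs => rw [h1, exp_spectralMatrix hU, ← spectralMatrix_one hU]
      simp only [spectralMatrix, ← sub_mul, ← mul_sub, Matrix.diagonal_sub]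
      rfl
    rw [this]
    exact posSemidef_spectralMatrix fun i => by
      simpa using hΦ.eigenvalues_nonneg i
  have h1 := dot_nonneg h hA
  rw [dot_sub_left, dot_comm 1, dot_one_right] at h1
  have h2 : 0 < A.trace :=
    lt_of_le_of_ne hA.trace_nonneg fun h => hA0 (hA.trace_eq_zero_iff.mp h.symm)
  linarith

theorem posSemidef_trace_smul_sub {A : Matrix (Fin n) (Fin n) ℝ} (hA : A.PosSemidef) :
    (A.trace • 1 - A).PosSemidef := by
  obtain ⟨U, hU, h1, -⟩ := exists_spectralMatrix hA.1
  have h0 : A.trace = ∑ i, hA.1.eigenvalues i := by simpa using hA.1.trace_eq_sum_eigenvalues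
  set a := hA.1.eigenvalues
  have : A.trace • 1 - A = spectralMatrix U (fun i => A.trace - a i) := by
    rw [← smul_one_sub_spectralMatrix hU, ← h1]
  rw [this]
  refine posSemidef_spectralMatrix fun i => ?_
  simp only [Pi.zero_apply, sub_nonneg, h0]
  exact Finset.single_le_sum (f := a) (fun j _ => hA.eigenvalues_nonneg j) (Finset.mem_univ i)

/-- Follows from `A ≤ (tr A) I`. It makes `1 / tr (F i)` a lower bound for the normalized optimum.
-/
theorem dot_le_trace_mul_trace {A B : Matrix (Fin n) (Fin n) ℝ} (hA : A.PosSemidef)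
    (hB : B.PosSemidef) : dot A B ≤ A.trace * B.trace := by
  have := dot_nonneg (posSemidef_trace_smul_sub hA) hB
  rw [dot_sub_left, dot_smul_left, dot_comm 1, dot_one_right] at this
  linarith

end MatrixAnalysis

end PSDP

/-! ### The multiplicative weights algorithm for the normalized program -/

namespace PSDP

open Matrix

noncomputable section

/-- The data that one step of the normalized algorithm updates: the dual weights `x`, the sum `acc`
of the `t` density matrices of the current phase, the current guess `μ` for the optimal value, and
the best primal solution `Y` so far. -/
structure Iterate (n m : ℕ) where
  x : Fin m → ℝ
  acc : Matrix (Fin n) (Fin n) ℝ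
  t : ℝ
  μ : ℝ
  Y : Matrix (Fin n) (Fin n) ℝ

namespace Iterate

variable {n m : ℕ} (F : Fin m → Matrix (Fin n) (Fin n) ℝ) (δ α : ℝ)

/-- The weighted sum of the constraint matrices. -/
def load (w : Iterate n m) : Matrix (Fin n) (Fin n) ℝ := ∑ i, w.x i • F i

/-- The exponential of the load. -/
def expLoad (w : Iterate n m) : Matrix (Fin n) (Fin n) ℝ := NormedSpace.exp (w.load F)

/-- The stopping criterion: the dual weights certify that the guess is nearly optimal. -/
def Stop (w : Iterate n m) : Prop :=
  Real.log (w.expLoad F).trace * w.μ ≤ (1 + 4 * δ) * ∑ i, w.x i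

open Classical in
/-- The updated dual weights. -/
def nextX (w : Iterate n m) : Fin m → ℝ := fun i =>
  w.x i + α * (if w.μ * dot (F i) (w.expLoad F) ≤ (1 + δ) * (w.expLoad F).trace then 1 else 0)
    * w.x i

/-- The updated sum of density matrices. -/
def nextAcc (w : Iterate n m) : Matrix (Fin n) (Fin n) ℝ :=
  w.acc + (1 / (w.expLoad F).trace) • w.expLoad F

/-- The factor by which a matrix has to be scaled to satisfy all normalized constraints. -/
def scaling (M : Matrix (Fin n) (Fin n) ℝ) : ℝ := ⨆ i, 1 / dot (F i) M

open Classical in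
/-- One step of the normalized algorithm. -/
def step (w : Iterate n m) : Iterate n m :=
  if scaling F (w.nextAcc F) * (w.t + 1) ≤ w.μ then
    { x := w.nextX F δ α
      acc := 0
      t := 0
      μ := w.μ / (1 + δ)
      Y := scaling F (w.nextAcc F) • w.nextAcc F }
  else
    { x := w.nextX F δ α
      acc := w.nextAcc F
      t := w.t + 1
      μ := w.μ
      Y := w.Y }

/-- The start of the normalized algorithm. -/
def start : Iterate n m where
  x := fun i => 1 / dot (F i) 1 * (1 / m)
  acc := 0
  t := 0
  μ := n * scaling F 1
  Y := scaling F 1 • 1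

/-- `Y` is feasible for the normalized program, in which zero matrices impose no constraint. -/
def Covers (Y : Matrix (Fin n) (Fin n) ℝ) : Prop :=
  Y.PosSemidef ∧ ∀ i, F i ≠ 0 → 1 ≤ dot (F i) Y

/-- The scale `(log n + 1) / δ` of the dual weights. -/
def width (n : ℕ) (δ : ℝ) : ℝ := (Real.log n + 1) / δ

/-- The step size. -/
def stepSize (n : ℕ) (δ : ℝ) : ℝ := δ / (4 * width n δ)

/-- A bound for the number of updates of a single dual weight. -/
def updateBound (n m : ℕ) (δ : ℝ) : ℝ :=
  Real.log (2 * n * m * width n δ) / Real.log (1 + stepSize n δ)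

/-- A bound for the length of a phase. -/
def phaseBound (n m : ℕ) (δ : ℝ) : ℝ := (1 + δ) * (updateBound n m δ + 1) / δ

/-- A bound for the number of steps. -/
def stepBound (n m : ℕ) (δ : ℝ) : ℝ :=
  (Real.log n / Real.log (1 + δ) + 1) * (phaseBound n m δ + 1) + phaseBound n m δ

/-- The invariant of the normalized algorithm. -/
structure Inv (w : Iterate n m) : Prop where
  x_nonneg : ∀ i, 0 ≤ w.x i
  one_le : ∀ i, F i ≠ 0 → 1 ≤ m * (F i).trace * w.x i
  x_zero : ∀ i, F i = 0 → w.x i = 0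
  acc_psd : w.acc.PosSemidef
  acc_trace : w.acc.trace = w.t
  t_nonneg : 0 ≤ w.t
  t_le : w.t ≤ phaseBound n m δ
  μ_pos : 0 < w.μ
  covers : Covers F w.Y
  trace_le : w.Y.trace ≤ (1 + δ) * w.μ
  potential : Real.log (w.expLoad F).trace
    ≤ Real.log n + 1 + (1 + 3 * δ) * ((∑ i, w.x i) / w.μ)
  coverage : ∀ i, F i ≠ 0 →
    (1 + δ) * (w.t - Real.log (m * (F i).trace * w.x i) / Real.log (1 + stepSize n δ))
      ≤ w.μ * dot (F i) w.acc

/-- The progress of the algorithm. -/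
def progress (w : Iterate n m) : ℝ :=
  Real.log (n * scaling F 1 / w.μ) / Real.log (1 + δ) * (phaseBound n m δ + 1) + w.t

variable {F δ α}

theorem load_posSemidef (hF : ∀ i, (F i).PosSemidef) {w : Iterate n m} (hw : ∀ i, 0 ≤ w.x i) :
    (w.load F).PosSemidef :=
  posSemidef_sum _ fun i _ => (hF i).smul (hw i)

theorem nextX_nonneg (hα : 0 ≤ α) {w : Iterate n m} (hw : ∀ i, 0 ≤ w.x i) (i : Fin m) :
    0 ≤ w.nextX F δ α i := by
  unfold nextX
  have := hw i
  split_ifs <;> simp only [mul_one, mul_zero, zero_mul, add_zero] <;> positivity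

theorem step_x (w : Iterate n m) : (w.step F δ α).x = w.nextX F δ α := by
  unfold step; split_ifs <;> rfl

theorem step_x_nonneg (hα : 0 ≤ α) {w : Iterate n m} (hw : ∀ i, 0 ≤ w.x i) (i : Fin m) :
    0 ≤ (w.step F δ α).x i := by
  rw [step_x]; exact nextX_nonneg hα hw i

theorem le_scaling (M : Matrix (Fin n) (Fin n) ℝ) (i : Fin m) :
    1 / dot (F i) M ≤ scaling F M :=
  le_ciSup (f := fun i => 1 / dot (F i) M) (Set.finite_range _).bddAbove i

theorem scaling_nonneg (hF : ∀ i, (F i).PosSemidef) {M : Matrix (Fin n) (Fin n) ℝ}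
    (hM : M.PosSemidef) : 0 ≤ scaling F M :=
  Real.iSup_nonneg fun i => one_div_nonneg.mpr (dot_nonneg (hF i) hM)

theorem trace_pos (hF : ∀ i, (F i).PosSemidef) {i : Fin m} (hi : F i ≠ 0) : 0 < (F i).trace :=
  lt_of_le_of_ne (hF i).trace_nonneg fun h => hi ((hF i).trace_eq_zero_iff.mp h.symm)

theorem scaling_one_pos (hF : ∀ i, (F i).PosSemidef) {i : Fin m} (hi : F i ≠ 0) :
    0 < scaling F 1 := by
  refine lt_of_lt_of_le ?_ (le_scaling 1 i)
  rw [dot_one_right]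
  exact one_div_pos.mpr (trace_pos hF hi)

/-- Zero matrices contribute `1 / 0 = 0` to the supremum in `scaling`, so they do not affect the
factor. -/
theorem covers_scaling (hF : ∀ i, (F i).PosSemidef) {M : Matrix (Fin n) (Fin n) ℝ}
    (hM : M.PosSemidef) (hpos : ∀ i, F i ≠ 0 → 0 < dot (F i) M) :
    Covers F (scaling F M • M) := by
  refine ⟨hM.smul (scaling_nonneg hF hM), fun i hi => ?_⟩
  rw [dot_smul_right]
  have := mul_le_mul_of_nonneg_right (le_scaling (F := F) M i) (hpos i hi).le
  rwa [one_div, inv_mul_cancel₀ (hpos i hi).ne'] at this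

theorem log_nat_pos (hn : 2 ≤ n) : 0 < Real.log n :=
  Real.log_pos (by exact_mod_cast hn)

theorem width_pos (hn : 2 ≤ n) (hδ : 0 < δ) : 0 < width n δ :=
  div_pos (by linarith [log_nat_pos hn]) hδ

theorem stepSize_pos (hn : 2 ≤ n) (hδ : 0 < δ) : 0 < stepSize n δ :=
  div_pos hδ (by linarith [width_pos hn hδ])

theorem one_le_width (hn : 2 ≤ n) (hδ : 0 < δ) (hδ' : δ ≤ 1 / 12) : 1 ≤ width n δ := by
  rw [width, le_div_iff₀ hδ]
  linarith [log_nat_pos hn]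

theorem updateBound_nonneg (hn : 2 ≤ n) (hm : 1 ≤ m) (hδ : 0 < δ) (hδ' : δ ≤ 1 / 12) :
    0 ≤ updateBound n m δ := by
  have h1 : (1 : ℝ) ≤ n := by exact_mod_cast (by omega : 1 ≤ n)
  have h2 : (1 : ℝ) ≤ m := by exact_mod_cast hm
  refine div_nonneg (Real.log_nonneg ?_) (Real.log_nonneg (by linarith [stepSize_pos hn hδ]))
  have h3 := one_le_width hn hδ hδ'
  have h4 : (1 : ℝ) ≤ n * m := one_le_mul_of_one_le_of_one_le h1 h2
  have h5 : (1 : ℝ) ≤ n * m * width n δ := one_le_mul_of_one_le_of_one_le h4 h3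
  nlinarith

theorem phaseBound_nonneg (hn : 2 ≤ n) (hm : 1 ≤ m) (hδ : 0 < δ) (hδ' : δ ≤ 1 / 12) :
    0 ≤ phaseBound n m δ := by
  have := updateBound_nonneg hn hm hδ hδ'
  unfold phaseBound
  positivity

/-- The initial weights make `m tr (F i) x i = 1` for nonzero `F i`, so the logarithm of this
quantity to base `1 + α` counts updates from zero. The load then has trace at most `1`, which
accounts for the `log n + 1` in the potential bound. -/
theorem inv_start (hF : ∀ i, (F i).PosSemidef) (hn : 2 ≤ n) (hm : 1 ≤ m)
    (hne : ∃ i, F i ≠ 0) (hδ : 0 < δ) (hδ' : δ ≤ 1 / 12) : Inv F δ (start F) := by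
  obtain ⟨i₀, hi₀⟩ := hne
  have hκ := scaling_one_pos hF hi₀
  have hn0 : (0 : ℝ) < n := by exact_mod_cast (by omega : 0 < n)
  have hm0 : (0 : ℝ) < m := by exact_mod_cast (by omega : 0 < m)
  have hx : ∀ i, 0 ≤ (start F).x i := fun i => by
    have := (hF i).trace_nonneg
    simp only [start, dot_one_right]
    positivity
  have hone : ∀ i, F i ≠ 0 → (m : ℝ) * (F i).trace * (start F).x i = 1 := fun i hi => by
    have := (trace_pos hF hi).ne'
    simp only [start, dot_one_right]
    field_simp
  have hx0 : ∀ i, F i = 0 → (start F).x i = 0 := fun i hi => by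
    simp [start, hi]
  refine ⟨hx, fun i hi => (hone i hi).ge, hx0, .zero, by simp [start], le_rfl,
    phaseBound_nonneg hn hm hδ hδ', mul_pos hn0 hκ, ?_, ?_, ?_, ?_⟩
  · exact covers_scaling hF .one fun i hi => by rw [dot_one_right]; exact trace_pos hF hi
  · simp only [start, Matrix.trace_smul, Matrix.trace_one, Fintype.card_fin, smul_eq_mul]
    have := mul_pos hn0 hκ
    nlinarith
  · have htr : ((start F).load F).trace ≤ 1 := by
      simp only [load, Matrix.trace_sum, Matrix.trace_smul, smul_eq_mul]
      calc ∑ i, (start F).x i * (F i).trace ≤ ∑ _i : Fin m, 1 / (m : ℝ) := by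
            refine Finset.sum_le_sum fun i _ => ?_
            by_cases hi : F i = 0
            · rw [hi]; simp
            · rw [le_div_iff₀ hm0]
              linarith [hone i hi]
        _ = 1 := by simp [hm0.ne']
    have hpsd := load_posSemidef hF hx
    have h1 := trace_exp_le hpsd htr
    have h2 := le_trace_exp hpsd
    have h3 := Real.log_le_log (hn0.trans_le h2) h1
    rw [Real.log_mul hn0.ne' (Real.exp_pos 1).ne', Real.log_exp] at h3
    have h4 : 0 ≤ (1 + 3 * δ) * ((∑ i, (start F).x i) / (start F).μ) :=
      mul_nonneg (by linarith) (div_nonneg (Finset.sum_nonneg fun i _ => hx i)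
        (mul_pos hn0 hκ).le)
    exact h3.trans (by linarith)
  · intro i hi
    rw [hone i hi]
    simp [start]

theorem trace_expLoad_ge (hF : ∀ i, (F i).PosSemidef) {w : Iterate n m} (hw : ∀ i, 0 ≤ w.x i) :
    (n : ℝ) ≤ (w.expLoad F).trace :=
  le_trace_exp (load_posSemidef hF hw)

/-- As long as the algorithm does not stop, the load stays bounded. -/
theorem Inv.log_trace_le (hn : 2 ≤ n) (hδ : 0 < δ) (hδ' : δ ≤ 1 / 12)
    {w : Iterate n m} (hw : Inv F δ w) (hs : ¬ w.Stop F δ) :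
    Real.log (w.expLoad F).trace ≤ 2 * width n δ := by
  have hμ := hw.μ_pos
  have hp := hw.potential
  unfold Stop at hs
  push Not at hs
  set ℓ := Real.log (w.expLoad F).trace
  set S := ∑ i, w.x i
  have hK : Real.log n + 1 = δ * width n δ := by unfold width; field_simp
  have hK1 := one_le_width hn hδ hδ'
  -- Comparing the failed criterion (`4δ`) with the potential bound (`3δ`) leaves `δ S / μ < log n +
  -- 1`. This gap is the reason for the definition of `width`.
  have h1 : (1 + 4 * δ) * (S / w.μ) < ℓ := by
    rw [mul_div_assoc', div_lt_iff₀ hμ]; exact hs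
  have h2 : S / w.μ < width n δ := by
    rw [hK] at hp
    nlinarith
  rw [hK] at hp
  nlinarith

/-- A single term is at most the trace of the load, which is at most `n` times its spectral bound.
Together with `Inv.log_trace_le` this limits how often one weight can grow. -/
theorem trace_mul_le (hF : ∀ i, (F i).PosSemidef) {w : Iterate n m} (hw : ∀ i, 0 ≤ w.x i)
    (i : Fin m) : (F i).trace * w.x i ≤ n * Real.log (w.expLoad F).trace := by
  have hpsd := load_posSemidef hF hw
  have h1 := (posSemidef_log_trace_exp_sub hpsd.1).trace_nonneg
  rw [Matrix.trace_sub, Matrix.trace_smul, Matrix.trace_one, Fintype.card_fin, smul_eq_mul] at h1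
  have h2 : w.x i * (F i).trace ≤ (w.load F).trace := by
    simp only [load, Matrix.trace_sum, Matrix.trace_smul, smul_eq_mul]
    exact Finset.single_le_sum (f := fun i => w.x i * (F i).trace)
      (fun j _ => mul_nonneg (hw j) (hF j).trace_nonneg) (Finset.mem_univ i)
  unfold expLoad
  linarith

/-- Only constraints with `μ (F i • W) ≤ (1 + δ) tr W` are increased, so the load increment `Δ` has
`W • Δ` at most `(1 + δ) tr W / μ` times the growth of `∑ x i`. The trace bound converts this into
growth of `log tr W`. -/
theorem potential_step (hF : ∀ i, (F i).PosSemidef) (hn : 2 ≤ n) (hδ : 0 < δ)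
    (hδ' : δ ≤ 1 / 12) {w : Iterate n m} (hw : Inv F δ w) (hs : ¬ w.Stop F δ) :
    Real.log (NormedSpace.exp (∑ i, w.nextX F δ (stepSize n δ) i • F i)).trace
      ≤ Real.log n + 1 + (1 + 3 * δ) * ((∑ i, w.nextX F δ (stepSize n δ) i) / w.μ) := by
  classical
  set α := stepSize n δ with hα
  have hα0 : 0 < α := stepSize_pos hn hδ
  have hμ := hw.μ_pos
  have hx := hw.x_nonneg
  have hK1 := one_le_width hn hδ hδ'
  have hℓ := hw.log_trace_le hn hδ hδ' hs
  have hpsd := load_posSemidef hF hx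
  set ind : Fin m → ℝ := fun i =>
    if w.μ * dot (F i) (w.expLoad F) ≤ (1 + δ) * (w.expLoad F).trace then 1 else 0 with hind
  have hind0 : ∀ i, 0 ≤ ind i := fun i => by simp only [hind]; split_ifs <;> norm_num
  have hind1 : ∀ i, ind i ≤ 1 := fun i => by simp only [hind]; split_ifs <;> norm_num
  have hd0 : ∀ i, 0 ≤ α * ind i * w.x i := fun i => by
    have := hind0 i; have := hx i; positivity
  have hnext : ∀ i, w.nextX F δ α i = w.x i + α * ind i * w.x i := fun i => rfl
  set Δ : Matrix (Fin n) (Fin n) ℝ := ∑ i, (α * ind i * w.x i) • F i with hΔ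
  have hΔpsd : Δ.PosSemidef := posSemidef_sum _ fun i _ => (hF i).smul (hd0 i)
  have hsum : ∑ i, w.nextX F δ α i • F i = w.load F + Δ := by
    simp only [hnext, add_smul, Finset.sum_add_distrib, hΔ, load]
  have hαK : 2 * width n δ * α = δ / 2 := by
    rw [hα, stepSize]
    have : width n δ ≠ 0 := by positivity
    field_simp
    norm_num
  -- `Δ ≤ α Φ ≤ α (log tr W) I ≤ 2 α width I = (δ / 2) I`. The step size is chosen for the last
  -- equality.
  have hΔle : ((δ / 2) • 1 - Δ).PosSemidef := by
    have e1 : (α • w.load F - Δ).PosSemidef := by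
      have : α • w.load F - Δ = ∑ i, (α * (1 - ind i) * w.x i) • F i := by
        simp only [load, hΔ, Finset.smul_sum, ← Finset.sum_sub_distrib, smul_smul, ← sub_smul]
        exact Finset.sum_congr rfl fun i _ => by congr 1; ring
      rw [this]
      exact posSemidef_sum _ fun i _ => (hF i).smul
        (mul_nonneg (mul_nonneg hα0.le (sub_nonneg.mpr (hind1 i))) (hx i))
    have e2 := (posSemidef_log_trace_exp_sub hpsd.1).smul hα0.le
    have e3 : ((δ / 2 - α * Real.log (w.expLoad F).trace) •
        (1 : Matrix (Fin n) (Fin n) ℝ)).PosSemidef := by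
      refine PosSemidef.one.smul ?_
      have := mul_le_mul_of_nonneg_left hℓ hα0.le
      linarith
    have := (e1.add e2).add e3
    convert this using 1
    simp only [sub_smul, smul_sub, smul_smul, expLoad]
    abel
  have hmain := trace_exp_add_le hpsd.1 hΔpsd (half_pos hδ) (by linarith) hΔle
  have hdot : w.μ * dot (w.expLoad F) Δ
      ≤ (1 + δ) * (w.expLoad F).trace * ∑ i, α * ind i * w.x i := by
    rw [hΔ, dot_sum_right, Finset.mul_sum, Finset.mul_sum]
    refine Finset.sum_le_sum fun i _ => ?_
    rw [dot_smul_right, dot_comm]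
    by_cases h : w.μ * dot (F i) (w.expLoad F) ≤ (1 + δ) * (w.expLoad F).trace
    · have := mul_le_mul_of_nonneg_left h (hd0 i)
      linarith
    · simp [hind, h]
  have hn0 : (0 : ℝ) < n := by exact_mod_cast (by omega : 0 < n)
  have htr : 0 < (w.expLoad F).trace := hn0.trans_le (trace_expLoad_ge hF hx)
  set D := ∑ i, α * ind i * w.x i with hD
  have hD0 : 0 ≤ D := Finset.sum_nonneg fun i _ => hd0 i
  have hSnext : ∑ i, w.nextX F δ α i = ∑ i, w.x i + D := by
    simp only [hnext, Finset.sum_add_distrib, hD]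
  have hcoef : (1 + δ / 2) / (1 - δ / 2) * (1 + δ) ≤ 1 + 3 * δ := by
    rw [div_mul_eq_mul_div, div_le_iff₀ (by linarith)]
    nlinarith
  have hcoef0 : 0 ≤ (1 + δ / 2) / (1 - δ / 2) := div_nonneg (by linarith) (by linarith)
  have hdot' : dot (w.expLoad F) Δ ≤ (1 + δ) * (w.expLoad F).trace * (D / w.μ) := by
    rw [mul_div_assoc', le_div_iff₀ hμ]
    linarith
  have hbound : (NormedSpace.exp (w.load F + Δ)).trace
      ≤ (w.expLoad F).trace * Real.exp ((1 + 3 * δ) * (D / w.μ)) := by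
    have hq : 0 ≤ D / w.μ := div_nonneg hD0 hμ.le
    calc (NormedSpace.exp (w.load F + Δ)).trace
        ≤ (w.expLoad F).trace + (1 + δ / 2) / (1 - δ / 2) * dot (w.expLoad F) Δ := hmain
      _ ≤ (w.expLoad F).trace + (1 + δ / 2) / (1 - δ / 2)
            * ((1 + δ) * (w.expLoad F).trace * (D / w.μ)) := by gcongr
      _ = (w.expLoad F).trace * ((1 + δ / 2) / (1 - δ / 2) * (1 + δ) * (D / w.μ) + 1) := by ring
      _ ≤ (w.expLoad F).trace * ((1 + 3 * δ) * (D / w.μ) + 1) := by gcongr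
      _ ≤ _ := by gcongr; exact Real.add_one_le_exp _
  rw [hsum, hSnext]
  have hpos' : 0 < (NormedSpace.exp (w.load F + Δ)).trace :=
    hn0.trans_le (le_trace_exp (hpsd.add hΔpsd))
  have := Real.log_le_log hpos' hbound
  rw [Real.log_mul htr.ne' (Real.exp_pos _).ne', Real.log_exp] at this
  have hp := hw.potential
  rw [add_div, mul_add]
  linarith

/-- Any covering matrix has trace at least `1 / tr (F i)`, and `w.Y` covers. So the guess cannot
fall far below `scaling F 1`, while it starts at `n` times that value. -/
theorem Inv.scaling_le (hF : ∀ i, (F i).PosSemidef) (hne : ∃ i, F i ≠ 0) {w : Iterate n m}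
    (hw : Inv F δ w) : scaling F 1 ≤ (1 + δ) * w.μ := by
  obtain ⟨i₀, hi₀⟩ := hne
  have : Nonempty (Fin m) := ⟨i₀⟩
  refine le_trans (ciSup_le fun i => ?_) hw.trace_le
  by_cases hi : F i = 0
  · simpa [hi] using hw.covers.1.trace_nonneg
  · have ht := trace_pos hF hi
    have h1 := (hw.covers.2 i hi).trans (dot_le_trace_mul_trace (hF i) hw.covers.1)
    rw [dot_one_right, div_le_iff₀ ht]
    linarith

theorem Inv.progress_le (hF : ∀ i, (F i).PosSemidef) (hn : 2 ≤ n) (hm : 1 ≤ m)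
    (hne : ∃ i, F i ≠ 0) (hδ : 0 < δ) (hδ' : δ ≤ 1 / 12) {w : Iterate n m} (hw : Inv F δ w) :
    w.progress F δ ≤ stepBound n m δ := by
  have hR := phaseBound_nonneg hn hm hδ hδ'
  have hn0 : (0 : ℝ) < n := by exact_mod_cast (by omega : 0 < n)
  have hlog : 0 < Real.log (1 + δ) := Real.log_pos (by linarith)
  have hμ := hw.μ_pos
  have hκ : 0 < scaling F 1 := scaling_one_pos hF hne.choose_spec
  have h1 : Real.log (n * scaling F 1 / w.μ) / Real.log (1 + δ)
      ≤ Real.log n / Real.log (1 + δ) + 1 := by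
    rw [div_add_one hlog.ne', ← Real.log_mul hn0.ne' (by linarith)]
    refine div_le_div_of_nonneg_right (Real.log_le_log (by positivity) ?_) hlog.le
    rw [div_le_iff₀ hμ, mul_assoc]
    exact mul_le_mul_of_nonneg_left (hw.scaling_le hF hne) hn0.le
  unfold progress stepBound
  have := hw.t_le
  gcongr

/-- The field `coverage` subtracts from `t` the number of updates of constraint `i` since the very
start. In each round either that count grows by one or `μ F i • acc` gains at least `1 + δ`. If the
phase goes on, some constraint still has `μ F i • acc < t`, and with the bounded update count this
forces `t ≤ phaseBound`. -/
theorem Inv.step (hF : ∀ i, (F i).PosSemidef) (hn : 2 ≤ n) (hm : 1 ≤ m)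
    (hδ : 0 < δ) (hδ' : δ ≤ 1 / 12) {w : Iterate n m} (hw : Inv F δ w) (hs : ¬ w.Stop F δ) :
    Inv F δ (w.step F δ (stepSize n δ)) := by
  have hpot := potential_step hF hn hδ hδ' hw hs
  have hℓ := hw.log_trace_le hn hδ hδ' hs
  set α := stepSize n δ with hα
  have hα0 : 0 < α := stepSize_pos hn hδ
  have hμ := hw.μ_pos
  have hx := hw.x_nonneg
  have hx' : ∀ i, 0 ≤ w.nextX F δ α i := nextX_nonneg hα0.le hx
  have hn0 : (0 : ℝ) < n := by exact_mod_cast (by omega : 0 < n)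
  have hm0 : (0 : ℝ) < m := by exact_mod_cast (by omega : 0 < m)
  have htr : 0 < (w.expLoad F).trace := hn0.trans_le (trace_expLoad_ge hF hx)
  have hpsd := load_posSemidef hF hx
  have hE : (w.expLoad F).PosSemidef := posSemidef_exp hpsd.1
  have hlog : 0 < Real.log (1 + α) := Real.log_pos (by linarith)
  have hacc : (w.nextAcc F).PosSemidef := hw.acc_psd.add (hE.smul (one_div_nonneg.mpr htr.le))
  have htrace : (w.nextAcc F).trace = w.t + 1 := by
    rw [nextAcc, Matrix.trace_add, Matrix.trace_smul, smul_eq_mul, one_div,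
      inv_mul_cancel₀ htr.ne', hw.acc_trace]
  have hdotacc : ∀ i, dot (F i) (w.nextAcc F)
      = dot (F i) w.acc + dot (F i) (w.expLoad F) / (w.expLoad F).trace := fun i => by
    rw [nextAcc, dot_add_right, dot_smul_right]; ring
  have hEpos : ∀ i, F i ≠ 0 → 0 < dot (F i) (w.expLoad F) := fun i hi => by
    rw [dot_comm]; exact dot_exp_pos hpsd (hF i) hi
  have haccpos : ∀ i, F i ≠ 0 → 0 < dot (F i) (w.nextAcc F) := fun i hi => by
    rw [hdotacc]
    exact add_pos_of_nonneg_of_pos (dot_nonneg (hF i) hw.acc_psd) (div_pos (hEpos i hi) htr)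
  have hxle : ∀ i, w.x i ≤ w.nextX F δ α i := fun i => by
    unfold nextX
    have := hx i
    split_ifs <;> (simp; try positivity)
  have hone : ∀ i, F i ≠ 0 → 1 ≤ m * (F i).trace * w.nextX F δ α i := fun i hi =>
    (hw.one_le i hi).trans
      (mul_le_mul_of_nonneg_left (hxle i) (mul_nonneg hm0.le (trace_pos hF hi).le))
  have hzero : ∀ i, F i = 0 → w.nextX F δ α i = 0 := fun i hi => by
    simp [nextX, hw.x_zero i hi]
  have hcov : ∀ i, F i ≠ 0 →
      (1 + δ) * (w.t + 1 - Real.log (m * (F i).trace * w.nextX F δ α i) / Real.log (1 + α))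
        ≤ w.μ * dot (F i) (w.nextAcc F) := fun i hi => by
    have hold := hw.coverage i hi
    have hy : 0 < m * (F i).trace * w.x i := lt_of_lt_of_le one_pos (hw.one_le i hi)
    rw [hdotacc, mul_add, mul_div_assoc']
    by_cases h : w.μ * dot (F i) (w.expLoad F) ≤ (1 + δ) * (w.expLoad F).trace
    · have e : m * (F i).trace * w.nextX F δ α i = (m * (F i).trace * w.x i) * (1 + α) := by
        simp only [nextX, if_pos h]; ring
      rw [e, Real.log_mul hy.ne' (by linarith), add_div, div_self hlog.ne']
      have : 0 ≤ w.μ * dot (F i) (w.expLoad F) / (w.expLoad F).trace :=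
        div_nonneg (mul_nonneg hμ.le (hEpos i hi).le) htr.le
      linarith
    · have e : w.nextX F δ α i = w.x i := by simp [nextX, if_neg h]
      rw [e]
      push Not at h
      have : 1 + δ ≤ w.μ * dot (F i) (w.expLoad F) / (w.expLoad F).trace := by
        rw [le_div_iff₀ htr]; exact h.le
      linarith
  have hlogle : ∀ i, F i ≠ 0 →
      Real.log (m * (F i).trace * w.nextX F δ α i) / Real.log (1 + α) ≤ updateBound n m δ + 1 :=
    fun i hi => by
    have hy : 0 < m * (F i).trace * w.x i := lt_of_lt_of_le one_pos (hw.one_le i hi)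
    -- The spectral bound is available only for the old weights, since the new iterate may already
    -- satisfy the stopping criterion. The extra factor `1 + α` is the `+ 1` beside `updateBound`.
    have e1 : m * (F i).trace * w.nextX F δ α i ≤ (2 * n * m * width n δ) * (1 + α) := by
      have b1 : w.nextX F δ α i ≤ w.x i * (1 + α) := by
        unfold nextX
        have := mul_nonneg hα0.le (hx i)
        split_ifs <;> nlinarith
      have b2 := (trace_mul_le hF hx i).trans (mul_le_mul_of_nonneg_left hℓ hn0.le)
      calc m * (F i).trace * w.nextX F δ α i
          ≤ m * (F i).trace * (w.x i * (1 + α)) :=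
            mul_le_mul_of_nonneg_left b1 (mul_nonneg hm0.le (trace_pos hF hi).le)
        _ = m * ((F i).trace * w.x i) * (1 + α) := by ring
        _ ≤ m * (n * (2 * width n δ)) * (1 + α) := by gcongr
        _ = _ := by ring
    have hwpos := width_pos hn hδ
    have e2 : Real.log ((2 * n * m * width n δ) * (1 + α))
        = Real.log (2 * n * m * width n δ) + Real.log (1 + α) :=
      Real.log_mul (by positivity) (by linarith)
    rw [updateBound, div_add_one hlog.ne', ← e2]
    exact div_le_div_of_nonneg_right
      (Real.log_le_log (lt_of_lt_of_le one_pos (hone i hi)) e1) hlog.le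
  unfold Iterate.step
  split_ifs with hq
  · have hμ' : w.μ / (1 + δ) ≤ w.μ := div_le_self hμ.le (by linarith)
    have hμ0 : 0 < w.μ / (1 + δ) := div_pos hμ (by linarith)
    refine ⟨hx', hone, hzero, .zero, by simp, le_rfl, phaseBound_nonneg hn hm hδ hδ', hμ0,
      covers_scaling hF hacc haccpos, ?_, ?_, ?_⟩
    · simp only [Matrix.trace_smul, smul_eq_mul, htrace]
      rw [mul_div_cancel₀ _ (by linarith)]
      exact hq
    · refine hpot.trans ?_
      have : (∑ i, w.nextX F δ α i) / w.μ ≤ (∑ i, w.nextX F δ α i) / (w.μ / (1 + δ)) :=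
        div_le_div_of_nonneg_left (Finset.sum_nonneg fun i _ => hx' i) hμ0 hμ'
      have := mul_le_mul_of_nonneg_left this (by linarith : 0 ≤ 1 + 3 * δ)
      simpa using this
    · intro i hi
      simp only [dot_zero_right, mul_zero, zero_sub]
      have := div_nonneg (Real.log_nonneg (hone i hi)) hlog.le
      nlinarith
  · refine ⟨hx', hone, hzero, hacc, htrace, by linarith [hw.t_nonneg], ?_, hμ, hw.covers,
      hw.trace_le, hpot, hcov⟩
    push Not at hq
    have hm' : Nonempty (Fin m) := ⟨⟨0, by omega⟩⟩
    -- The worst covered constraint is the one with `μ F i • acc < t`. It is nonzero because its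
    -- reciprocal is positive.
    obtain ⟨i, hi⟩ := exists_eq_ciSup_of_finite (f := fun i => 1 / dot (F i) (w.nextAcc F))
    rw [scaling, ← hi] at hq
    have hi0 : F i ≠ 0 := fun h => by
      simp only [h, dot_zero_left, div_zero, zero_mul] at hq
      linarith
    have hd := haccpos i hi0
    rw [one_div_mul_eq_div, lt_div_iff₀ hd] at hq
    have h1 := hcov i hi0
    have h2 := hlogle i hi0
    show w.t + 1 ≤ phaseBound n m δ
    rw [phaseBound, le_div_iff₀ hδ]
    have := mul_le_mul_of_nonneg_left h2 (by linarith : 0 ≤ 1 + δ)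
    linarith

/-- Ending a phase loses `t ≤ phaseBound` but earns `phaseBound + 1`; any other step increases `t`
by one. -/
theorem Inv.progress_step (hF : ∀ i, (F i).PosSemidef) (hn : 2 ≤ n)
    (hne : ∃ i, F i ≠ 0) (hδ : 0 < δ) {w : Iterate n m} (hw : Inv F δ w) :
    w.progress F δ + 1 ≤ (w.step F δ α).progress F δ := by
  have hlog : 0 < Real.log (1 + δ) := Real.log_pos (by linarith)
  have hn0 : (0 : ℝ) < n := by exact_mod_cast (by omega : 0 < n)
  have hμ := hw.μ_pos
  have hκ : 0 < scaling F 1 := scaling_one_pos hF hne.choose_spec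
  have ht := hw.t_le
  unfold Iterate.step
  split_ifs with hq
  · simp only [progress]
    have e : n * scaling F 1 / (w.μ / (1 + δ)) = n * scaling F 1 / w.μ * (1 + δ) := by
      rw [div_div_eq_mul_div, mul_div_right_comm]
    rw [e, Real.log_mul (by positivity) (by linarith), add_div, div_self hlog.ne']
    linarith
  · simp only [progress]
    linarith

/-- Weak duality: pairing `Φ ≤ (log tr W) I` with a covering `Z` gives `∑ x i ≤ (log tr W) tr Z`,
and the stopping criterion turns this into `μ ≤ (1 + 4δ) tr Z`. -/
theorem Stop.trace_le (hF : ∀ i, (F i).PosSemidef) (hn : 2 ≤ n) (hδ : 0 < δ)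
    {w : Iterate n m} (hw : Inv F δ w) (hs : w.Stop F δ) {Z : Matrix (Fin n) (Fin n) ℝ}
    (hZ : Covers F Z) : w.Y.trace ≤ (1 + δ) * (1 + 4 * δ) * Z.trace := by
  have hpsd := load_posSemidef hF hw.x_nonneg
  have h1 := dot_nonneg (posSemidef_log_trace_exp_sub hpsd.1) hZ.1
  rw [dot_sub_left, dot_smul_left, dot_comm 1, dot_one_right] at h1
  have h2 : ∑ i, w.x i ≤ dot (w.load F) Z := by
    rw [dot_comm, load, dot_sum_right]
    refine Finset.sum_le_sum fun i _ => ?_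
    rw [dot_smul_right, dot_comm]
    by_cases hi : F i = 0
    · rw [hw.x_zero i hi]; simp
    · have := mul_le_mul_of_nonneg_left (hZ.2 i hi) (hw.x_nonneg i)
      linarith
  have hn2 : (2 : ℝ) ≤ n := by exact_mod_cast hn
  have hℓ : 0 < Real.log (w.expLoad F).trace :=
    Real.log_pos (by linarith [trace_expLoad_ge hF hw.x_nonneg])
  have h3 : w.μ ≤ (1 + 4 * δ) * Z.trace := by
    unfold Stop at hs
    have h4 : ∑ i, w.x i ≤ Real.log (w.expLoad F).trace * Z.trace := by
      unfold expLoad; linarith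
    have h5 := hs.trans (mul_le_mul_of_nonneg_left h4 (by linarith : 0 ≤ 1 + 4 * δ))
    refine le_of_mul_le_mul_left ?_ hℓ
    linarith
  have := hw.trace_le
  have := mul_le_mul_of_nonneg_left h3 (by linarith : 0 ≤ 1 + δ)
  linarith

/-- The normalized algorithm stops with a nearly optimal solution. -/
theorem exists_stop (hF : ∀ i, (F i).PosSemidef) (hn : 2 ≤ n) (hδ : 0 < δ) (hδ' : δ ≤ 1 / 12) :
    ∃ k : ℕ, ((step F δ (stepSize n δ))^[k] (start F)).Stop F δ ∧
      (∀ j < k, ¬ ((step F δ (stepSize n δ))^[j] (start F)).Stop F δ) ∧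
      (k = 0 ∨ 1 ≤ m ∧ (k : ℝ) ≤ stepBound n m δ) ∧
      Covers F ((step F δ (stepSize n δ))^[k] (start F)).Y ∧
      ∀ Z, Covers F Z → ((step F δ (stepSize n δ))^[k] (start F)).Y.trace
        ≤ (1 + δ) * (1 + 4 * δ) * Z.trace := by
  by_cases hne : ∃ i, F i ≠ 0
  · have hm : 1 ≤ m := by
      obtain ⟨i, -⟩ := hne
      have := i.2
      omega
    set f := step F δ (stepSize n δ)
    have hinv : ∀ k, (∀ j < k, ¬ (f^[j] (start F)).Stop F δ) →
        Inv F δ (f^[k] (start F)) ∧ (k : ℝ) ≤ (f^[k] (start F)).progress F δ := by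
      intro k
      induction k with
      | zero =>
        intro _
        refine ⟨inv_start hF hn hm hne hδ hδ', ?_⟩
        have hκ : 0 < scaling F 1 := scaling_one_pos hF hne.choose_spec
        have hn0 : (0 : ℝ) < n := by exact_mod_cast (by omega : 0 < n)
        simp [progress, start, div_self (mul_pos hn0 hκ).ne']
      | succ k ih =>
        intro h
        obtain ⟨h1, h2⟩ := ih fun j hj => h j (by omega)
        rw [Function.iterate_succ_apply']
        refine ⟨h1.step hF hn hm hδ hδ' (h k (by omega)), ?_⟩
        have := h1.progress_step (α := stepSize n δ) hF hn hne hδ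
        push_cast
        linarith
    have hex : ∃ k, (f^[k] (start F)).Stop F δ := by
      by_contra hno
      push Not at hno
      obtain ⟨N, hN⟩ := exists_nat_gt (stepBound n m δ)
      obtain ⟨h1, h2⟩ := hinv N fun j _ => hno j
      linarith [h1.progress_le hF hn hm hne hδ hδ']
    classical
    obtain ⟨h1, h2⟩ := hinv (Nat.find hex) fun j hj => Nat.find_min hex hj
    exact ⟨Nat.find hex, Nat.find_spec hex, fun j hj => Nat.find_min hex hj,
      .inr ⟨hm, h2.trans (h1.progress_le hF hn hm hne hδ hδ')⟩, h1.covers,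
      fun Z hZ => (Nat.find_spec hex).trace_le hF hn hδ h1 hZ⟩
  · push Not at hne
    have h0 : scaling F 1 = 0 := by simp [scaling, hne]
    refine ⟨0, ?_, by simp, .inl rfl, ?_, fun Z hZ => ?_⟩
    -- Without nonzero constraints the initial guess and the weights vanish, so the criterion reads
    -- `0 ≤ 0` at once.
    · simp [Stop, start, h0, hne]
    · simp only [Function.iterate_zero, id, start, h0, zero_smul]
      exact ⟨.zero, fun i hi => absurd (hne i) hi⟩
    · simp only [Function.iterate_zero, id, start, h0, zero_smul, Matrix.trace_zero]
      have := hZ.1.trace_nonneg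
      positivity

end Iterate

end

end PSDP

/-! ### Explicit estimates for the number of steps -/

namespace PSDP

theorem half_le_log_two : (1 / 2 : ℝ) ≤ Real.log 2 := by linarith [Real.log_two_gt_d9]

theorem half_mul_le_log_one_add {y : ℝ} (h0 : 0 < y) (h1 : y ≤ 1) : y / 2 ≤ Real.log (1 + y) := by
  refine le_trans ?_ (Real.one_sub_inv_le_log_of_pos (by linarith))
  rw [← one_div, one_sub_div (by linarith), le_div_iff₀ (by linarith)]
  nlinarith

/-- The reciprocal of `log (1 + α)` is of order `log n / e²`, and the numerator is of order `log n +
log m + log (1/e)`. Since `log n` and `log (1/e)` are at least `1/2`, constants and sums are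
absorbed into products. -/
theorem updateBound_le {n m : ℕ} (hn : 2 ≤ n) (hm : 1 ≤ m) {e : ℝ} (he : 0 < e)
    (he' : e ≤ 1 / 2) :
    Iterate.updateBound n m (e / 6)
      ≤ 336 * (Real.log n * ((Real.log n + Real.log m) * Real.log (1 / e))) * (6 / e) ^ 2 := by
  have hn0 : (0 : ℝ) < n := by exact_mod_cast (by omega : 0 < n)
  have hm0 : (0 : ℝ) < m := by exact_mod_cast (by omega : 0 < m)
  have hL : 1 / 2 ≤ Real.log n := half_le_log_two.trans
    (Real.log_le_log (by norm_num) (by exact_mod_cast hn))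
  have hL2 : Real.log 2 ≤ Real.log n := Real.log_le_log (by norm_num) (by exact_mod_cast hn)
  have hM : 0 ≤ Real.log m := Real.log_nonneg (by exact_mod_cast hm)
  have hE : 1 / 2 ≤ Real.log (1 / e) := half_le_log_two.trans
    (Real.log_le_log (by norm_num) (by rw [le_div_iff₀ he]; linarith))
  set L := Real.log n
  set M := Real.log m
  set E := Real.log (1 / e)
  have hδ : 0 < e / 6 := by positivity
  have hwpos := Iterate.width_pos hn hδ
  have hw1 := Iterate.one_le_width hn hδ (by linarith)
  have hα := Iterate.stepSize_pos hn hδ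
  have hα1 : Iterate.stepSize n (e / 6) ≤ 1 := by
    rw [Iterate.stepSize, div_le_one (by positivity)]; linarith
  have hlogα := half_mul_le_log_one_add hα hα1
  have hinv : 1 / Real.log (1 + Iterate.stepSize n (e / 6)) ≤ 24 * L * (6 / e) ^ 2 := by
    refine (one_div_le_one_div_of_le (half_pos hα) hlogα).trans ?_
    have : 1 / (Iterate.stepSize n (e / 6) / 2) = 8 * (L + 1) * (6 / e) ^ 2 := by
      have : L + 1 ≠ 0 := by positivity
      simp only [Iterate.stepSize, Iterate.width]
      change 1 / (e / 6 / (4 * ((L + 1) / (e / 6))) / 2) = _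
      field_simp
      norm_num
    rw [this]
    exact mul_le_mul_of_nonneg_right (by linarith) (sq_nonneg _)
  have hlogK : Real.log (2 * n * m * Iterate.width n (e / 6)) ≤ 14 * ((L + M) * E) := by
    have e1 : Iterate.width n (e / 6) = (L + 1) * (6 * (1 / e)) := by
      simp only [Iterate.width]
      change (L + 1) / (e / 6) = _
      field_simp
    have hL1 : 0 < L + 1 := by linarith
    have e2 : Real.log (2 * n * m * Iterate.width n (e / 6))
        = Real.log 2 + L + M + (Real.log (L + 1) + (Real.log 6 + E)) := by
      rw [e1, Real.log_mul (by positivity) (by positivity), Real.log_mul (by positivity) hm0.ne',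
        Real.log_mul (by norm_num) hn0.ne', Real.log_mul hL1.ne' (by positivity),
        Real.log_mul (by norm_num) (by positivity)]
    have e3 : Real.log (L + 1) ≤ L := by
      have := Real.log_le_sub_one_of_pos hL1
      linarith
    have e4 : Real.log 6 ≤ 3 * Real.log 2 := by
      have : (3 : ℝ) * Real.log 2 = Real.log (2 ^ 3) := by rw [Real.log_pow]; norm_num
      rw [this]
      exact Real.log_le_log (by norm_num) (by norm_num)
    rw [e2]
    nlinarith [mul_nonneg (by linarith : 0 ≤ L) (by linarith : 0 ≤ E - 1 / 2),
      mul_nonneg hM (by linarith : 0 ≤ E - 1 / 2),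
      mul_nonneg (by linarith : 0 ≤ L - 1 / 2) (by linarith : 0 ≤ E)]
  have hnum : 0 ≤ Real.log (2 * n * m * Iterate.width n (e / 6)) := by
    refine Real.log_nonneg ?_
    have h1 : (1 : ℝ) ≤ n := by exact_mod_cast (by omega : 1 ≤ n)
    have h2 : (1 : ℝ) ≤ m := by exact_mod_cast hm
    have h3 : (1 : ℝ) ≤ n * m := one_le_mul_of_one_le_of_one_le h1 h2
    have h5 := one_le_mul_of_one_le_of_one_le h3 hw1
    nlinarith
  rw [Iterate.updateBound, div_eq_mul_one_div]
  calc _ ≤ 14 * ((L + M) * E) * (24 * L * (6 / e) ^ 2) := by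
        refine mul_le_mul hlogK hinv (one_div_nonneg.mpr (by linarith)) ?_
        positivity
    _ = _ := by ring

/-- The number of steps in terms of `n`, `m` and the accuracy. -/
theorem stepBound_le {n m : ℕ} (hn : 2 ≤ n) (hm : 1 ≤ m) {e : ℝ} (he : 0 < e)
    (he' : e ≤ 1 / 2) :
    Iterate.stepBound n m (e / 6)
      ≤ 7000000 * ((1 / e) ^ 4 * Real.log n ^ 4 * Real.log (1 / e))
        * (1 + Real.log m / Real.log n) := by
  have hL : 1 / 2 ≤ Real.log n := half_le_log_two.trans
    (Real.log_le_log (by norm_num) (by exact_mod_cast hn))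
  have hM : 0 ≤ Real.log m := Real.log_nonneg (by exact_mod_cast hm)
  have hE : 1 / 2 ≤ Real.log (1 / e) := half_le_log_two.trans
    (Real.log_le_log (by norm_num) (by rw [le_div_iff₀ he]; linarith))
  have hU := updateBound_le hn hm he he'
  have hU0 := Iterate.updateBound_nonneg hn hm (by positivity : 0 < e / 6) (by linarith)
  have hlogδ := half_mul_le_log_one_add (y := e / 6) (by positivity) (by linarith)
  set U := Iterate.updateBound n m (e / 6) with hUdef
  set L := Real.log n
  set M := Real.log m
  set E := Real.log (1 / e)
  have hd : 12 ≤ 6 / e := by rw [le_div_iff₀ he]; linarith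
  have hde : e / 6 * (6 / e) = 1 := by field_simp
  have hPeq : Iterate.phaseBound n m (e / 6) = (1 + e / 6) * (U + 1) * (6 / e) := by
    rw [Iterate.phaseBound, ← hUdef]; field_simp
  set d := 6 / e with hddef
  set X := L * ((L + M) * E) with hX
  have hX0 : 1 / 8 ≤ X := by
    have h1 : 1 / 4 ≤ (L + M) * E := by nlinarith
    nlinarith
  have hU1 : U + 1 ≤ 337 * X * d ^ 2 := by
    have : 1 ≤ X * d ^ 2 := by nlinarith [sq_nonneg (d - 12)]
    linarith
  have hP : Iterate.phaseBound n m (e / 6) ≤ 674 * X * d ^ 3 := by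
    rw [hPeq]
    calc (1 + e / 6) * (U + 1) * d ≤ 2 * (337 * X * d ^ 2) * d := by
          gcongr; linarith
      _ = _ := by ring
  have hP1 : Iterate.phaseBound n m (e / 6) + 1 ≤ 675 * X * d ^ 3 := by
    have : 1 ≤ X * d ^ 3 := by
      have h3 : (12 : ℝ) ^ 3 ≤ d ^ 3 := pow_le_pow_left₀ (by norm_num) hd 3
      nlinarith
    linarith
  have hP0 : 0 ≤ Iterate.phaseBound n m (e / 6) :=
    Iterate.phaseBound_nonneg hn hm (by positivity) (by linarith)
  have hN : L / Real.log (1 + e / 6) + 1 ≤ 3 * (L * d) := by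
    have h1 : L / Real.log (1 + e / 6) ≤ L / (e / 6 / 2) :=
      div_le_div_of_nonneg_left (by linarith) (by positivity) hlogδ
    have h2 : L / (e / 6 / 2) = 2 * (L * d) := by rw [hddef]; field_simp
    have h3 : 1 ≤ L * d := by nlinarith
    linarith
  have hX00 : 0 ≤ X := by linarith
  have hL0 : 0 < L := by linarith
  have hd0 : 0 < d := by linarith
  have hLd : 1 ≤ L * d := by nlinarith
  have hfin : Iterate.stepBound n m (e / 6) ≤ 2699 * (L * X) * d ^ 4 := by
    have s1 : (L / Real.log (1 + e / 6) + 1) * (Iterate.phaseBound n m (e / 6) + 1)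
        ≤ 3 * (L * d) * (675 * X * d ^ 3) :=
      mul_le_mul hN hP1 (by linarith) (by positivity)
    have s2 : 674 * X * d ^ 3 ≤ 674 * X * d ^ 3 * (L * d) :=
      le_mul_of_one_le_right (by positivity) hLd
    calc Iterate.stepBound n m (e / 6)
        = (L / Real.log (1 + e / 6) + 1) * (Iterate.phaseBound n m (e / 6) + 1)
          + Iterate.phaseBound n m (e / 6) := rfl
      _ ≤ 3 * (L * d) * (675 * X * d ^ 3) + 674 * X * d ^ 3 * (L * d) := by linarith
      _ = _ := by ring
  refine hfin.trans ?_
  have hE0 : 0 < E := by linarith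
  have e1 : 7000000 * ((1 / e) ^ 4 * L ^ 4 * E) * (1 + M / L)
      = 7000000 * ((1 / e) ^ 4 * L ^ 3 * E * (L + M)) := by
    field_simp
  have e2 : 2699 * (L * X) * d ^ 4 = 3497904 * ((1 / e) ^ 4 * L ^ 2 * E * (L + M)) := by
    rw [hX, hddef, show (6 : ℝ) / e = 6 * (1 / e) by ring]; ring
  rw [e1, e2]
  -- One factor `log n` is given away here to reach the fourth power.
  have : L ^ 2 ≤ 2 * L ^ 3 := by nlinarith [sq_nonneg L]
  calc 3497904 * ((1 / e) ^ 4 * L ^ 2 * E * (L + M))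
      ≤ 3497904 * ((1 / e) ^ 4 * (2 * L ^ 3) * E * (L + M)) := by gcongr
    _ = 6995808 * ((1 / e) ^ 4 * L ^ 3 * E * (L + M)) := by ring
    _ ≤ _ := by gcongr; norm_num

/-- Absorbs the one additional iteration that comes from rounding up. -/
theorem one_le_iterationBound {n : ℕ} (hn : 2 ≤ n) {e : ℝ} (he : 0 < e) (he' : e ≤ 1 / 2) :
    1 ≤ 2 * ((1 / e) ^ 4 * Real.log n ^ 4 * Real.log (1 / e)) := by
  have hL : 1 / 2 ≤ Real.log n := half_le_log_two.trans
    (Real.log_le_log (by norm_num) (by exact_mod_cast hn))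
  have h2 : 2 ≤ 1 / e := by rw [le_div_iff₀ he]; linarith
  have hE : 1 / 2 ≤ Real.log (1 / e) := half_le_log_two.trans
    (Real.log_le_log (by norm_num) h2)
  calc (1 : ℝ) = 2 * (2 ^ 4 * (1 / 2) ^ 4 * (1 / 2)) := by norm_num
    _ ≤ _ := by gcongr

end PSDP

/-! ### The program and its correctness on iterates -/

namespace PSDP

open Matrix

noncomputable section

/-- A sequence of primitives as a program. -/
def block : List Instr → Prog
  | [] => .skip
  | i :: l => .seq (.prim i) (block l)

/-- The effect of a sequence of primitives. -/
def run {n m : ℕ} (s : State n m) : List Instr → State n m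
  | [] => s
  | i :: l => run (i.apply s) l

/-- A sequence of primitives that may be applied one after the other. -/
def LegalRun {n m : ℕ} (s : State n m) : List Instr → Prop
  | [] => True
  | i :: l => i.Legal s ∧ LegalRun (i.apply s) l

theorem exec_block {n m : ℕ} {l : List Instr} {s : State n m} (h : LegalRun s l) :
    Exec (block l) s l.length (run s l) := by
  induction l generalizing s with
  | nil => exact .skip s
  | cons i l ih =>
    rw [List.length_cons, add_comm]
    exact .seq (.prim i s h.1) (ih h.2)

/-- Computes the exponential of the load and both sides of the stopping criterion. -/
def expInstrs : List Instr :=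
  [.expDotPairs 20 5, .mHadamard 21 20 3, .mMul 22 21 4, .mMul 23 4 21, .mAdd 22 22 23,
    .mScale 22 14 22, .mAdd 20 20 22, .mScale 20 15 20, .mDot 20 20 3, .sLog 21 20,
    .sMul 22 21 10, .vSum 23 1, .sMul 24 5 23]

/-- Updates the dual weights and the load. -/
def dualInstrs : List Instr :=
  [.fDot 20 1 20, .vConst 21 10, .vMul 20 21 20, .sMul 25 4 20, .vConst 21 25, .vLe 20 20 21,
    .vConst 21 6, .vMul 20 21 20, .vMul 20 20 1, .vAdd 1 1 20, .fScale 20 1 1, .fSum 5 20]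

/-- Updates the sum of density matrices and tests whether it covers all constraints. -/
def primalInstrs : List Instr :=
  [.sDiv 26 9 20, .mScale 21 26 20, .mAdd 6 6 21, .sAdd 11 11 9, .fDot 22 1 6, .vConst 23 9,
    .vDiv 22 23 22, .vMax 27 22, .sMul 28 27 11]

/-- Records a primal solution and starts a new phase. -/
def phaseInstrs : List Instr :=
  [.mScale 7 27 6, .sDiv 10 10 4, .mScale 6 8 6, .sConst 11 0]

/-- One step of the normalized algorithm. -/
def stepProg : Prog :=
  .seq (block expInstrs) (.cond ⟨22, 24⟩ (block [.sConst 12 1])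
    (.seq (block dualInstrs) (.seq (block primalInstrs)
      (.cond ⟨28, 10⟩ (block phaseInstrs) .skip))))

/-- One iteration. -/
def bodyProg : Prog :=
  .seq (block [.sConst 13 0]) (.loop ⟨13, 7⟩ (.seq stepProg (block [.sAdd 13 13 9])))

/-- Constants of the algorithm. -/
def constInstrs : List Instr :=
  [.sConst 20 6, .sDiv 3 17 20, .sAdd 4 9 3, .sConst 20 4, .sMul 21 20 3, .sAdd 5 9 21,
    .sLog 21 1, .sAdd 22 21 9, .sDiv 22 22 3, .sMul 22 20 22, .sDiv 6 3 22, .sLog 23 2,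
    .sDiv 7 23 21]

/-- Normalization of the program. -/
def normInstrs : List Instr :=
  [.mOne 3, .mOnes 4, .mInvSqrt 1 0, .mMul 20 1 0, .mMul 20 20 1, .sConst 24 (-1),
    .mScale 20 24 20, .mAdd 2 3 20, .fDot 20 0 2, .vDiv 21 0 20, .vMax 16 21, .vConst 22 8,
    .vLe 23 20 22, .vDiv 23 23 0, .fMulLeft 1 1 0, .fMulRight 1 1 1, .fScale 1 23 1]

/-- The start of the normalized algorithm. -/
def startInstrs : List Instr :=
  [.fDot 20 1 3, .vConst 21 9, .vDiv 20 21 20, .vMax 25 20, .sDiv 26 9 2, .vConst 21 26,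
    .vMul 1 20 21, .fScale 20 1 1, .fSum 5 20, .mScale 7 25 3, .sMul 10 1 25]

/-- Basic constants and the truncation of the accuracy. -/
def inputProg : Prog :=
  .seq (block [.sConst 9 1, .sConst 15 (1 / 2), .sConst 14 (-1 / 4)])
    (.cond ⟨0, 15⟩ (block [.sAdd 17 0 8]) (block [.sAdd 17 15 8]))

/-- The preparation. -/
def prepProg : Prog :=
  .seq inputProg (.seq (block constInstrs) (.seq (block normInstrs) (block startInstrs)))

/-- The finish. -/
def finishInstrs : List Instr :=
  [.mMul 0 1 7, .mMul 0 0 1, .mScale 20 16 2, .mAdd 0 0 20]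

/-- The approximation algorithm for positive semidefinite programs. -/
def approxAlgorithm : Algorithm where
  prep := prepProg
  guard := ⟨12, 8⟩
  body := bodyProg
  finish := block finishInstrs
  body_ok := by
    simp [bodyProg, stepProg, block, expInstrs, dualInstrs, primalInstrs, phaseInstrs,
      Prog.NoInvSqrt]

section

variable {n m : ℕ}

/-- The values that stay fixed during the iterations. -/
structure Params (n m : ℕ) where
  F : Fin m → Matrix (Fin n) (Fin n) ℝ
  δ : ℝ
  α : ℝ
  r : ℝ
  H : Matrix (Fin n) (Fin n) ℝ
  Q : Matrix (Fin n) (Fin n) ℝ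
  q : ℝ

/-- The memory `s` holds the parameters `p`, the iterate `w`, the flag `d` and the counter `j`. -/
structure Holds (p : Params n m) (s : State n m) (w : Iterate n m) (d j : ℝ) : Prop where
  s4 : s.scal 4 = 1 + p.δ
  s5 : s.scal 5 = 1 + 4 * p.δ
  s6 : s.scal 6 = p.α
  s7 : s.scal 7 = p.r
  s8 : s.scal 8 = 0
  s9 : s.scal 9 = 1
  s10 : s.scal 10 = w.μ
  s11 : s.scal 11 = w.t
  s12 : s.scal 12 = d
  s13 : s.scal 13 = j
  s14 : s.scal 14 = -1 / 4
  s15 : s.scal 15 = 1 / 2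
  s16 : s.scal 16 = p.q
  v1 : s.vec 1 = w.x
  m1 : s.mat 1 = p.H
  m2 : s.mat 2 = p.Q
  m3 : s.mat 3 = 1
  m4 : s.mat 4 = Matrix.of fun _ _ => 1
  m5 : s.mat 5 = w.load p.F
  m6 : s.mat 6 = w.acc
  m7 : s.mat 7 = w.Y
  f1 : s.fam 1 = p.F

theorem dot_pairMatrix (W : Matrix (Fin n) (Fin n) ℝ) (j k : Fin n) :
    dot W (pairMatrix j k) = W j j + W j k + W k j + W k k := by
  simp only [dot, pairMatrix, Matrix.vecMulVec_apply, Pi.add_apply, add_mul, mul_add,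
    Finset.sum_add_distrib]
  simp [Pi.single_apply]
  ring

/-- A symmetric matrix is determined by its products with the matrices `pairMatrix j k`. -/
theorem recover_from_pairs {W : Matrix (Fin n) (Fin n) ℝ} (hW : Wᵀ = W) :
    (1 / 2 : ℝ) • ((Matrix.of fun j k => dot W (pairMatrix j k)) + (-1 / 4 : ℝ) •
      ((Matrix.of fun j k => dot W (pairMatrix j k) * (1 : Matrix (Fin n) (Fin n) ℝ) j k)
          * (Matrix.of fun _ _ => 1)
        + (Matrix.of fun _ _ => 1) * (Matrix.of fun j k => dot W (pairMatrix j k)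
          * (1 : Matrix (Fin n) (Fin n) ℝ) j k))) = W := by
  -- The table has entries `W j j + 2 W j k + W k k`. Its diagonal is `4 W j j`, which products with
  -- the all-ones matrix spread over rows and columns, so a quarter of it removes the diagonal
  -- terms.
  ext j k
  have h : W k j = W j k := congrFun (congrFun hW j) k
  simp only [Matrix.smul_apply, Matrix.add_apply, Matrix.of_apply, Matrix.mul_apply, smul_eq_mul,
    dot_pairMatrix, Matrix.one_apply, mul_ite, mul_one, mul_zero, one_mul, Finset.sum_ite_eq,
    Finset.sum_ite_eq', Finset.mem_univ, if_true, h]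
  ring

theorem holds_expInstrs {p : Params n m} {s : State n m} {w : Iterate n m} {d j : ℝ}
    (h : Holds p s w d j) (hpsd : (w.load p.F).PosSemidef) :
    LegalRun s expInstrs ∧ Holds p (run s expInstrs) w d j
      ∧ (run s expInstrs).mat 20 = w.expLoad p.F
      ∧ (run s expInstrs).scal 20 = (w.expLoad p.F).trace
      ∧ (run s expInstrs).scal 22 = Real.log (w.expLoad p.F).trace * w.μ
      ∧ (run s expInstrs).scal 24 = (1 + 4 * p.δ) * ∑ i, w.x i := by
  have hW := recover_from_pairs (transpose_eq_of_isHermitian (posSemidef_exp hpsd.1).1)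
  refine ⟨?_, ?_, ?_, ?_, ?_, ?_⟩
  · simp [LegalRun, expInstrs, Instr.Legal, h.m5, hpsd]
  · constructor <;> simp [run, expInstrs, Instr.apply, State.setScal, State.setMat,
      h.s4, h.s5, h.s6, h.s7, h.s8, h.s9, h.s10, h.s11, h.s12, h.s13, h.s14, h.s15, h.s16, h.v1,
      h.m1, h.m2, h.m3, h.m4, h.m5, h.m6, h.m7, h.f1]
  all_goals
    simp only [run, expInstrs, Instr.apply, State.setScal, State.setMat,
      Function.update_apply, Nat.reduceEqDiff, if_true, if_false,
      h.s5, h.s10, h.s14, h.s15, h.v1, h.m3, h.m4, h.m5, expDotVal, Matrix.of_apply, hW,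
      Iterate.expLoad, dot_one_right]

theorem holds_dualInstrs {p : Params n m} {s : State n m} {w : Iterate n m} {d j : ℝ}
    (h : Holds p s w d j) (hW : s.mat 20 = w.expLoad p.F)
    (htr : s.scal 20 = (w.expLoad p.F).trace) :
    LegalRun s dualInstrs ∧ Holds p (run s dualInstrs) { w with x := w.nextX p.F p.δ p.α } d j
      ∧ (run s dualInstrs).mat 20 = w.expLoad p.F
      ∧ (run s dualInstrs).scal 20 = (w.expLoad p.F).trace := by
  refine ⟨?_, ?_, ?_, ?_⟩
  · simp [LegalRun, dualInstrs, Instr.Legal]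
  · constructor <;> simp [run, dualInstrs, Instr.apply, State.setScal, State.setVec, State.setMat,
      State.setFam,
      h.s4, h.s5, h.s6, h.s7, h.s8, h.s9, h.s10, h.s11, h.s12, h.s13, h.s14, h.s15, h.s16, h.v1,
      h.m1, h.m2, h.m3, h.m4, h.m6, h.m7, h.f1, hW, htr, Iterate.load]
    · funext i
      simp [Iterate.nextX]
    · refine Finset.sum_congr rfl fun i _ => ?_
      simp [Iterate.nextX]
  · simp [run, dualInstrs, Instr.apply, State.setScal, State.setVec, State.setMat,
      State.setFam, hW]
  · simp [run, dualInstrs, Instr.apply, State.setScal, State.setVec, State.setMat,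
      State.setFam, htr]

theorem holds_primalInstrs {p : Params n m} {s : State n m} {w : Iterate n m} {d j : ℝ}
    (h : Holds p s w d j) {W : Matrix (Fin n) (Fin n) ℝ} (hW : s.mat 20 = W)
    (htr : s.scal 20 = W.trace) :
    LegalRun s primalInstrs
      ∧ Holds p (run s primalInstrs)
          { w with acc := w.acc + (1 / W.trace) • W, t := w.t + 1 } d j
      ∧ (run s primalInstrs).scal 27 = Iterate.scaling p.F (w.acc + (1 / W.trace) • W)
      ∧ (run s primalInstrs).scal 28
          = Iterate.scaling p.F (w.acc + (1 / W.trace) • W) * (w.t + 1) := by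
  refine ⟨?_, ?_, ?_, ?_⟩
  · simp [LegalRun, primalInstrs, Instr.Legal]
  · constructor <;> simp [run, primalInstrs, Instr.apply, State.setScal, State.setVec,
      State.setMat, h.s4, h.s5, h.s6, h.s7, h.s8, h.s9, h.s10, h.s11, h.s12, h.s13, h.s14, h.s15,
      h.s16, h.v1, h.m1, h.m2, h.m3, h.m4, h.m5, h.m6, h.m7, h.f1, hW, htr, Iterate.load]
  · simp [run, primalInstrs, Instr.apply, State.setScal, State.setVec, State.setMat, h.s9, h.m6,
      h.f1, hW, htr, Iterate.scaling]
  · simp [run, primalInstrs, Instr.apply, State.setScal, State.setVec, State.setMat, h.s9, h.s11,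
      h.m6, h.f1, hW, htr, Iterate.scaling]

theorem holds_phaseInstrs {p : Params n m} {s : State n m} {w : Iterate n m} {d j : ℝ}
    (h : Holds p s w d j) {c : ℝ} (hc : s.scal 27 = c) :
    LegalRun s phaseInstrs
      ∧ Holds p (run s phaseInstrs)
          { x := w.x, acc := 0, t := 0, μ := w.μ / (1 + p.δ), Y := c • w.acc } d j := by
  refine ⟨?_, ?_⟩
  · simp [LegalRun, phaseInstrs, Instr.Legal]
  · constructor <;> simp [run, phaseInstrs, Instr.apply, State.setScal,
      State.setMat, h.s4, h.s5, h.s6, h.s7, h.s8, h.s9, h.s10, h.s12, h.s13, h.s14, h.s15,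
      h.s16, h.v1, h.m1, h.m2, h.m3, h.m4, h.m5, h.m6, h.f1, hc, Iterate.load]

open Classical in
/-- The step on iterates together with the flag that records that the algorithm has stopped. -/
def flaggedStep (F : Fin m → Matrix (Fin n) (Fin n) ℝ) (δ α : ℝ) (w : Iterate n m × ℝ) :
    Iterate n m × ℝ :=
  if w.1.Stop F δ then (w.1, 1) else (w.1.step F δ α, w.2)

theorem exec_stepProg {p : Params n m} {s : State n m} {w : Iterate n m × ℝ} {j : ℝ}
    (h : Holds p s w.1 w.2 j) (hpsd : (w.1.load p.F).PosSemidef) :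
    ∃ (s' : State n m) (k : ℕ), k ≤ 40 ∧ Exec stepProg s k s' ∧
      Holds p s' (flaggedStep p.F p.δ p.α w).1 (flaggedStep p.F p.δ p.α w).2 j := by
  obtain ⟨l1, h1, hW1, htr1, hl, hr⟩ := holds_expInstrs h hpsd
  set s1 := run s expInstrs
  have e1 : Exec (block expInstrs) s 13 s1 := exec_block l1
  by_cases hs : w.1.Stop p.F p.δ
  · refine ⟨_, _, ?_, .seq e1 (.condTrue ?_ (exec_block (l := [.sConst 12 1]) ?_)), ?_⟩
    · simp
    · simp only [Test.Holds, hl, hr]; exact hs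
    · simp [LegalRun, Instr.Legal]
    · rw [flaggedStep, if_pos hs]
      constructor <;> simp [run, Instr.apply, State.setScal,
        h1.s4, h1.s5, h1.s6, h1.s7, h1.s8, h1.s9, h1.s10, h1.s11, h1.s13, h1.s14, h1.s15,
        h1.s16, h1.v1, h1.m1, h1.m2, h1.m3, h1.m4, h1.m5, h1.m6, h1.m7, h1.f1]
  · have hs' : ¬ (Test.mk 22 24).Holds s1 := by
      simp only [Test.Holds, hl, hr]; exact hs
    obtain ⟨l2, h2, hW2, htr2⟩ := holds_dualInstrs h1 hW1 htr1
    set s2 := run s1 dualInstrs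
    obtain ⟨l3, h3, h27, h28⟩ := holds_primalInstrs h2 hW2 htr2
    set s3 := run s2 primalInstrs
    have e2 : Exec (block dualInstrs) s1 12 s2 := exec_block l2
    have e3 : Exec (block primalInstrs) s2 9 s3 := exec_block l3
    rw [flaggedStep, if_neg hs, Iterate.step]
    by_cases hq : Iterate.scaling p.F (w.1.nextAcc p.F) * (w.1.t + 1) ≤ w.1.μ
    · obtain ⟨l4, h4⟩ := holds_phaseInstrs h3 h27
      have hq' : (Test.mk 28 10).Holds s3 := by
        simp only [Test.Holds, h28, h3.s10]; exact hq
      rw [if_pos hq]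
      exact ⟨_, _, by simp [phaseInstrs],
        .seq e1 (.condFalse hs' (.seq e2 (.seq e3 (.condTrue hq' (exec_block l4))))), h4⟩
    · have hq' : ¬ (Test.mk 28 10).Holds s3 := by
        simp only [Test.Holds, h28, h3.s10]; exact hq
      rw [if_neg hq]
      exact ⟨_, _, by simp,
        .seq e1 (.condFalse hs' (.seq e2 (.seq e3 (.condFalse hq' (.skip _))))), h3⟩

theorem flaggedStep_x_nonneg {F : Fin m → Matrix (Fin n) (Fin n) ℝ} {δ α : ℝ} (hα : 0 ≤ α)
    {w : Iterate n m × ℝ} (hw : ∀ i, 0 ≤ w.1.x i) (i : Fin m) :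
    0 ≤ (flaggedStep F δ α w).1.x i := by
  unfold flaggedStep
  split_ifs
  · exact hw i
  · exact Iterate.step_x_nonneg hα hw i

/-- The counter starts at zero and the test is `≤`, so the loop makes `⌊r⌋ + 1` rounds. Each costs
at most `40` steps for `stepProg`, one for the increment and one for the test. -/
theorem exec_innerLoop {p : Params n m} (hF : ∀ i, (p.F i).PosSemidef) (hα : 0 ≤ p.α)
    (hr : 0 ≤ p.r) (k : ℕ) : ∀ {s : State n m} {w : Iterate n m × ℝ} {j : ℕ},
    Holds p s w.1 w.2 j → (∀ i, 0 ≤ w.1.x i) → j + k = ⌊p.r⌋₊ + 1 →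
    ∃ (s' : State n m) (l : ℕ), l ≤ 42 * k + 1 ∧
      Exec (.loop ⟨13, 7⟩ (.seq stepProg (block [.sAdd 13 13 9]))) s l s' ∧
      Holds p s' ((flaggedStep p.F p.δ p.α)^[k] w).1 ((flaggedStep p.F p.δ p.α)^[k] w).2
        (⌊p.r⌋₊ + 1 : ℕ) := by
  induction k with
  | zero =>
    intro s w j h hx hj
    refine ⟨s, 1, by simp, .loopFalse ?_, ?_⟩
    · simp only [Test.Holds, h.s13, h.s7, not_le]
      rw [← Nat.floor_lt hr]
      omega
    · rw [← hj]; exact h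
  | succ k ih =>
    intro s w j h hx hj
    obtain ⟨s1, k1, hk1, e1, h1⟩ := exec_stepProg h (Iterate.load_posSemidef hF hx)
    have e2 : Exec (block [.sAdd 13 13 9]) s1 1 (run s1 [.sAdd 13 13 9]) :=
      exec_block (by simp [LegalRun, Instr.Legal])
    have h2 : Holds p (run s1 [.sAdd 13 13 9]) (flaggedStep p.F p.δ p.α w).1
        (flaggedStep p.F p.δ p.α w).2 (j + 1 : ℕ) := by
      constructor <;> simp [run, Instr.apply, State.setScal,
        h1.s4, h1.s5, h1.s6, h1.s7, h1.s8, h1.s9, h1.s10, h1.s11, h1.s12, h1.s13, h1.s14, h1.s15,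
        h1.s16, h1.v1, h1.m1, h1.m2, h1.m3, h1.m4, h1.m5, h1.m6, h1.m7, h1.f1]
    obtain ⟨s', l, hl, e3, h3⟩ := ih h2 (flaggedStep_x_nonneg hα hx) (by omega)
    refine ⟨s', _, ?_, .loopTrue ?_ (.seq e1 e2) e3, ?_⟩
    · omega
    · simp only [Test.Holds, h.s13, h.s7]
      rw [← Nat.le_floor_iff hr]
      omega
    · rw [Function.iterate_succ_apply]; exact h3

theorem exec_bodyProg {p : Params n m} (hF : ∀ i, (p.F i).PosSemidef) (hα : 0 ≤ p.α)
    (hr : 0 ≤ p.r) {s : State n m} {w : Iterate n m × ℝ} {j : ℝ}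
    (h : Holds p s w.1 w.2 j) (hx : ∀ i, 0 ≤ w.1.x i) :
    ∃ (s' : State n m) (l : ℕ), (l : ℝ) ≤ 50 * (1 + p.r) ∧ Exec bodyProg s l s' ∧
      Holds p s' ((flaggedStep p.F p.δ p.α)^[⌊p.r⌋₊ + 1] w).1
        ((flaggedStep p.F p.δ p.α)^[⌊p.r⌋₊ + 1] w).2 (⌊p.r⌋₊ + 1 : ℕ) := by
  have e1 : Exec (block [.sConst 13 0]) s 1 (run s [.sConst 13 0]) :=
    exec_block (by simp [LegalRun, Instr.Legal])
  have h1 : Holds p (run s [.sConst 13 0]) w.1 w.2 (0 : ℕ) := by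
    constructor <;> simp [run, Instr.apply, State.setScal,
      h.s4, h.s5, h.s6, h.s7, h.s8, h.s9, h.s10, h.s11, h.s12, h.s14, h.s15,
      h.s16, h.v1, h.m1, h.m2, h.m3, h.m4, h.m5, h.m6, h.m7, h.f1]
  obtain ⟨s', l, hl, e2, h2⟩ := exec_innerLoop hF hα hr (⌊p.r⌋₊ + 1) h1 hx (by omega)
  refine ⟨s', _, ?_, .seq e1 e2, h2⟩
  have h3 : ((1 + l : ℕ) : ℝ) ≤ ((42 * (⌊p.r⌋₊ + 1) + 2 : ℕ) : ℝ) := by exact_mod_cast (by omega)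
  push_cast at h3 ⊢
  have := Nat.floor_le hr
  linarith

theorem exec_finish {p : Params n m} {s : State n m} {w : Iterate n m} {d j : ℝ}
    (h : Holds p s w d j) :
    ∃ s', Exec (block finishInstrs) s 4 s' ∧ s'.mat 0 = p.H * w.Y * p.H + p.q • p.Q := by
  refine ⟨_, exec_block (l := finishInstrs) (by simp [LegalRun, finishInstrs, Instr.Legal]), ?_⟩
  simp [run, finishInstrs, Instr.apply, State.setMat, h.s16, h.m1, h.m2, h.m7]

end

end

end PSDP

/-! ### Normalization by the inverse square root of the objective -/

namespace PSDP

open Matrix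

noncomputable section

variable {n m : ℕ}

theorem exists_sqrt {A : Matrix (Fin n) (Fin n) ℝ} (hA : A.PosSemidef) :
    ∃ S : Matrix (Fin n) (Fin n) ℝ, Sᵀ = S ∧ S * S = A := by
  obtain ⟨U, hU, h1, -⟩ := exists_spectralMatrix hA.1
  refine ⟨spectralMatrix U fun i => √(hA.1.eigenvalues i), spectralMatrix_transpose _, ?_⟩
  rw [spectralMatrix_mul hU]
  conv_rhs => rw [h1]
  congr 1
  ext i
  exact Real.mul_self_sqrt (hA.eigenvalues_nonneg i)

/-- With square roots `S` of `A` and `R` of `B`, the dot product is the squared Frobenius norm of `S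
R`. -/
theorem mul_eq_zero_of_dot_eq_zero {A B : Matrix (Fin n) (Fin n) ℝ} (hA : A.PosSemidef)
    (hB : B.PosSemidef) (h : dot A B = 0) : A * B = 0 := by
  obtain ⟨S, hS, rfl⟩ := exists_sqrt hA
  obtain ⟨R, hR, rfl⟩ := exists_sqrt hB
  have h1 : (S * R * (S * R)ᴴ).trace = 0 := by
    rw [Matrix.conjTranspose_eq_transpose_of_trivial, Matrix.transpose_mul, hS, hR, ← h,
      dot_eq_trace, Matrix.transpose_mul, hS, Matrix.mul_assoc, Matrix.trace_mul_comm,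
      Matrix.trace_mul_comm (S * S)]
    simp only [Matrix.mul_assoc]
  rw [Matrix.trace_mul_conjTranspose_self_eq_zero_iff] at h1
  calc S * S * (R * R) = S * (S * R) * R := by simp only [Matrix.mul_assoc]
    _ = 0 := by rw [h1]; simp

/-- The inverse square root on the support. -/
def invSqrt (C : Matrix (Fin n) (Fin n) ℝ) : Matrix (Fin n) (Fin n) ℝ :=
  cfc (fun x : ℝ => (Real.sqrt x)⁻¹) C

/-- The projection to the kernel of a positive semidefinite matrix. -/
def kernelProj (C : Matrix (Fin n) (Fin n) ℝ) : Matrix (Fin n) (Fin n) ℝ :=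
  1 + (-1 : ℝ) • (invSqrt C * C * invSqrt C)

/-- Everything is diagonal in the eigenbasis of `C`. The witness `G` is the square root of `C`,
which inverts `invSqrt C` on the support. -/
theorem invSqrt_spec {C : Matrix (Fin n) (Fin n) ℝ} (hC : C.PosSemidef) :
    (invSqrt C)ᵀ = invSqrt C ∧ (kernelProj C).PosSemidef ∧ dot C (kernelProj C) = 0 ∧
      invSqrt C * C * invSqrt C = 1 - kernelProj C ∧
      ∃ G : Matrix (Fin n) (Fin n) ℝ, Gᵀ = G ∧ G * G = C ∧ G * invSqrt C = 1 - kernelProj C ∧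
        invSqrt C * G = 1 - kernelProj C := by
  obtain ⟨U, hU, h1, h2⟩ := exists_spectralMatrix hC.1
  have hc := hC.eigenvalues_nonneg
  set c := hC.1.eigenvalues
  have eH : invSqrt C = spectralMatrix U (fun i => (√(c i))⁻¹) := h2 _
  have hpt : ∀ i, (√(c i))⁻¹ * c i * (√(c i))⁻¹ = if c i = 0 then 0 else 1 := fun i => by
    split_ifs with h
    · simp [h]
    · have h3 : √(c i) ≠ 0 := (Real.sqrt_pos.mpr (lt_of_le_of_ne (hc i) (Ne.symm h))).ne'
      have h4 := Real.mul_self_sqrt (hc i)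
      field_simp
      rw [sq]
      exact h4.symm
  have eHCH : invSqrt C * C * invSqrt C
      = spectralMatrix U (fun i => if c i = 0 then 0 else 1) := by
    rw [eH]
    conv_lhs => rw [h1]
    rw [spectralMatrix_mul hU, spectralMatrix_mul hU]
    congr 1
    ext i
    exact hpt i
  have eP : kernelProj C = spectralMatrix U (fun i => if c i = 0 then 1 else 0) := by
    have := smul_one_sub_spectralMatrix hU 1 (fun i => if c i = 0 then 0 else 1)
    rw [kernelProj, eHCH, neg_one_smul, ← sub_eq_add_neg, ← one_smul ℝ (1 : Matrix _ _ ℝ), this]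
    congr 1
    ext i
    split_ifs <;> simp
  have eQ : invSqrt C * C * invSqrt C = 1 - kernelProj C := by
    rw [kernelProj, neg_one_smul]; abel
  have hpt2 : ∀ i, √(c i) * (√(c i))⁻¹ = if c i = 0 then 0 else 1 := fun i => by
    split_ifs with h
    · simp [h]
    · exact mul_inv_cancel₀ (Real.sqrt_pos.mpr (lt_of_le_of_ne (hc i) (Ne.symm h))).ne'
  refine ⟨?_, ?_, ?_, eQ, spectralMatrix U (fun i => √(c i)), spectralMatrix_transpose _, ?_, ?_,
    ?_⟩
  · rw [eH, spectralMatrix_transpose]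
  · rw [eP]
    exact posSemidef_spectralMatrix fun i => by
      simp only [Pi.zero_apply]; split_ifs <;> norm_num
  · rw [eP]
    conv_lhs => rw [h1]
    rw [dot_eq_trace, spectralMatrix_transpose, spectralMatrix_mul hU]
    have : (c * fun i => if c i = 0 then (1 : ℝ) else 0) = 0 := by
      ext i
      by_cases h : c i = 0 <;> simp [h]
    rw [this]
    simp [spectralMatrix]
  · rw [spectralMatrix_mul hU]
    conv_rhs => rw [h1]
    congr 1
    ext i
    exact Real.mul_self_sqrt (hc i)
  · rw [← eQ, eHCH, eH, spectralMatrix_mul hU]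
    congr 1
    ext i
    exact hpt2 i
  · rw [← eQ, eHCH, eH, spectralMatrix_mul hU]
    congr 1
    ext i
    exact (mul_comm _ _).trans (hpt2 i)

namespace PositiveSDP

variable (P : PositiveSDP n m)

open Classical in
/-- The constraint matrices of the normalized program: constraints that the kernel of `C` satisfies
at no cost are dropped. -/
def normalized : Fin m → Matrix (Fin n) (Fin n) ℝ := fun i =>
  ((if dot (P.A i) (kernelProj P.C) ≤ 0 then 1 else 0) / P.b i) •
    (invSqrt P.C * P.A i * invSqrt P.C)

/-- The multiple of the projection to the kernel of `C` that satisfies the dropped constraints. -/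
def kernelScale : ℝ := ⨆ i, P.b i / dot (P.A i) (kernelProj P.C)

variable {P}

theorem conj_posSemidef {H A : Matrix (Fin n) (Fin n) ℝ} (hH : Hᵀ = H) (hA : A.PosSemidef) :
    (H * A * H).PosSemidef := by
  have := hA.mul_mul_conjTranspose_same H
  rwa [Matrix.conjTranspose_eq_transpose_of_trivial, hH] at this

theorem normalized_posSemidef (i : Fin m) : (P.normalized i).PosSemidef := by
  refine (conj_posSemidef (invSqrt_spec P.C_psd).1 (P.A_psd i)).smul ?_
  have := P.b_nonneg i
  split_ifs <;> positivity

/-- A constraint matrix that is not dropped annihilates the kernel of `C`, so conjugating by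
`C^{-1/2}` and then by `C^{1/2}` loses nothing. -/
theorem conj_support {A K : Matrix (Fin n) (Fin n) ℝ} (hA : A.PosSemidef) (hK : K.PosSemidef)
    (h : dot A K ≤ 0) : (1 - K) * A * (1 - K) = A := by
  have h0 : A * K = 0 := mul_eq_zero_of_dot_eq_zero hA hK (le_antisymm h (dot_nonneg hA hK))
  have h1 : K * A = 0 := by
    have := congrArg Matrix.transpose h0
    rwa [Matrix.transpose_mul, transpose_eq_of_isHermitian hA.1,
      transpose_eq_of_isHermitian hK.1, Matrix.transpose_zero] at this
  simp [sub_mul, mul_sub, h0, h1]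

theorem conj_conj {G H Q : Matrix (Fin n) (Fin n) ℝ} (hGH : G * H = Q) (hHG : H * G = Q)
    (A : Matrix (Fin n) (Fin n) ℝ) : G * (H * A * H) * G = Q * A * Q := by
  calc G * (H * A * H) * G = (G * H) * A * (H * G) := by simp only [Matrix.mul_assoc]
    _ = Q * A * Q := by rw [hGH, hHG]

/-- The kernel term handles the dropped constraints and the conjugate of `Y` the others. Feasibility
of the program excludes `A i = 0` with `b i > 0`, which normalization would treat as no constraint.
-/
theorem isFeasible_of_covers (hfeas : ∃ Y, P.IsFeasible Y) {Y : Matrix (Fin n) (Fin n) ℝ}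
    (hY : Iterate.Covers P.normalized Y) :
    P.IsFeasible (invSqrt P.C * Y * invSqrt P.C + P.kernelScale • kernelProj P.C) := by
  obtain ⟨hH, hK, hCK, hHCH, G, hG, hGG, hGH, hHG⟩ := invSqrt_spec P.C_psd
  have hs : 0 ≤ P.kernelScale :=
    Real.iSup_nonneg fun i => div_nonneg (P.b_nonneg i) (dot_nonneg (P.A_psd i) hK)
  have hHY := conj_posSemidef hH hY.1
  refine ⟨hHY.add (hK.smul hs), fun i => ?_⟩
  rw [dot_add_right, dot_smul_right]
  have h1 := dot_nonneg (P.A_psd i) hHY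
  have h2 := dot_nonneg (P.A_psd i) hK
  rcases lt_or_ge 0 (dot (P.A i) (kernelProj P.C)) with hp | hp
  · have h3 : P.b i / dot (P.A i) (kernelProj P.C) ≤ P.kernelScale :=
      le_ciSup (f := fun i => P.b i / dot (P.A i) (kernelProj P.C))
        (Set.finite_range _).bddAbove i
    rw [div_le_iff₀ hp] at h3
    linarith
  · rcases (P.b_nonneg i).eq_or_lt with hb | hb
    · rw [← hb]; positivity
    · have hF : P.normalized i = (1 / P.b i) • (invSqrt P.C * P.A i * invSqrt P.C) := by
        simp [normalized, hp]
      have hne : P.normalized i ≠ 0 := by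
        intro h0
        rw [hF, smul_eq_zero_iff_right (by positivity)] at h0
        have h3 : P.A i = 0 := by
          rw [← conj_support (P.A_psd i) hK hp, ← conj_conj hGH hHG, h0]
          simp
        obtain ⟨Z, hZ⟩ := hfeas
        have := hZ.2 i
        rw [h3, dot_zero_left] at this
        linarith
      have h3 := hY.2 i hne
      rw [hF, dot_smul_left, dot_conj hH, one_div_mul_eq_div, le_div_iff₀ hb, one_mul] at h3
      have := mul_nonneg hs h2
      linarith

theorem dot_solution_le {Y : Matrix (Fin n) (Fin n) ℝ} (hY : Y.PosSemidef) :
    dot P.C (invSqrt P.C * Y * invSqrt P.C + P.kernelScale • kernelProj P.C) ≤ Y.trace := by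
  obtain ⟨hH, hK, hCK, hHCH, -⟩ := invSqrt_spec P.C_psd
  rw [dot_add_right, dot_smul_right, hCK, mul_zero, add_zero, ← dot_conj hH, hHCH, dot_sub_left,
    dot_comm 1, dot_one_right]
  linarith [dot_nonneg hK hY]

/-- The witness is `C^{1/2} Z C^{1/2}`. Hence the normalized optimum is no larger than the original
one. -/
theorem covers_of_isFeasible {Z : Matrix (Fin n) (Fin n) ℝ} (hZ : P.IsFeasible Z) :
    ∃ Z', Iterate.Covers P.normalized Z' ∧ Z'.trace = dot P.C Z := by
  obtain ⟨hH, hK, hCK, hHCH, G, hG, hGG, hGH, hHG⟩ := invSqrt_spec P.C_psd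
  refine ⟨G * Z * G, ⟨conj_posSemidef hG hZ.1, fun i hi => ?_⟩, ?_⟩
  · by_cases hp : dot (P.A i) (kernelProj P.C) ≤ 0
    · have hF : P.normalized i = (1 / P.b i) • (invSqrt P.C * P.A i * invSqrt P.C) := by
        simp [normalized, hp]
      have hb : 0 < P.b i := by
        refine lt_of_le_of_ne (P.b_nonneg i) fun h => hi ?_
        rw [hF, ← h]; simp
      have h3 : G * (invSqrt P.C * P.A i * invSqrt P.C) * G = P.A i :=
        (conj_conj hGH hHG _).trans (conj_support (P.A_psd i) hK hp)
      rw [hF, dot_smul_left, ← dot_conj hG, h3, one_div_mul_eq_div, le_div_iff₀ hb, one_mul]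
      exact hZ.2 i
    · exact absurd (by simp [normalized, hp]) hi
  · rw [← dot_one_right, dot_conj hG, Matrix.mul_one, hGG, dot_comm]

theorem isApprox_of_covers (hfeas : ∃ Y, P.IsFeasible Y) {ε c : ℝ} (hc0 : 0 ≤ c)
    (hc : c ≤ 1 + ε) {Y : Matrix (Fin n) (Fin n) ℝ} (hY : Iterate.Covers P.normalized Y)
    (hopt : ∀ Z, Iterate.Covers P.normalized Z → Y.trace ≤ c * Z.trace) :
    P.IsApprox ε (invSqrt P.C * Y * invSqrt P.C + P.kernelScale • kernelProj P.C) := by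
  refine ⟨isFeasible_of_covers hfeas hY, ?_⟩
  have hne : {v | ∃ Z, P.IsFeasible Z ∧ v = dot P.C Z}.Nonempty := by
    obtain ⟨Z, hZ⟩ := hfeas
    exact ⟨_, Z, hZ, rfl⟩
  have h0 : 0 ≤ sInf {v | ∃ Z, P.IsFeasible Z ∧ v = dot P.C Z} := by
    refine Real.sInf_nonneg ?_
    rintro v ⟨Z, hZ, rfl⟩
    exact dot_nonneg P.C_psd hZ.1
  refine le_trans ?_ (mul_le_mul_of_nonneg_right hc h0)
  refine (dot_solution_le hY.1).trans ?_
  rcases hc0.eq_or_lt with rfl | hc0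
  · obtain ⟨Z, hZ⟩ := hfeas
    obtain ⟨Z', hZ', -⟩ := covers_of_isFeasible hZ
    simpa using hopt Z' hZ'
  · rw [← div_le_iff₀' hc0]
    refine le_csInf hne ?_
    rintro v ⟨Z, hZ, rfl⟩
    obtain ⟨Z', hZ', e⟩ := covers_of_isFeasible hZ
    rw [div_le_iff₀' hc0, ← e]
    exact hopt Z' hZ'

/-- The accuracy of the algorithm for the normalized program. -/
def accuracy (ε : ℝ) : ℝ := min ε (1 / 2) / 6

/-- The fixed values of the algorithm on input `P` and `ε`. -/
def params (P : PositiveSDP n m) (ε : ℝ) : Params n m where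
  F := P.normalized
  δ := accuracy ε
  α := Iterate.stepSize n (accuracy ε)
  r := Real.log m / Real.log n
  H := invSqrt P.C
  Q := kernelProj P.C
  q := P.kernelScale

end PositiveSDP

/-! ### Correctness of the preparation -/

open PositiveSDP

/-- The memory still holds the input, the basic constants and the truncated accuracy. -/
structure HoldsInput (P : PositiveSDP n m) (ε : ℝ) (s : State n m) : Prop where
  s1 : s.scal 1 = n
  s2 : s.scal 2 = m
  s8 : s.scal 8 = 0
  s9 : s.scal 9 = 1
  s11 : s.scal 11 = 0
  s12 : s.scal 12 = 0
  s13 : s.scal 13 = 0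
  s14 : s.scal 14 = -1 / 4
  s15 : s.scal 15 = 1 / 2
  s17 : s.scal 17 = min ε (1 / 2)
  v0 : s.vec 0 = P.b
  m0 : s.mat 0 = P.C
  m6 : s.mat 6 = 0
  f0 : s.fam 0 = P.A

/-- In addition the memory holds the constants that depend on the accuracy. -/
structure HoldsConst (P : PositiveSDP n m) (ε : ℝ) (s : State n m) : Prop
    extends HoldsInput P ε s where
  s4 : s.scal 4 = 1 + accuracy ε
  s5 : s.scal 5 = 1 + 4 * accuracy ε
  s6 : s.scal 6 = Iterate.stepSize n (accuracy ε)
  s7 : s.scal 7 = Real.log m / Real.log n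

/-- In addition the memory holds the normalized program. -/
structure HoldsNorm (P : PositiveSDP n m) (ε : ℝ) (s : State n m) : Prop
    extends HoldsConst P ε s where
  s16 : s.scal 16 = P.kernelScale
  m1 : s.mat 1 = invSqrt P.C
  m2 : s.mat 2 = kernelProj P.C
  m3 : s.mat 3 = 1
  m4 : s.mat 4 = Matrix.of fun _ _ => 1
  f1 : s.fam 1 = P.normalized

theorem exec_input (P : PositiveSDP n m) (ε : ℝ) :
    ∃ s, Exec inputProg (initialState P ε) 5 s ∧ HoldsInput P ε s := by
  have e1 : Exec (block [.sConst 9 1, .sConst 15 (1 / 2), .sConst 14 (-1 / 4)])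
      (initialState P ε) 3 _ := exec_block (by simp [LegalRun, Instr.Legal])
  set s1 := run (initialState P ε) [.sConst 9 1, .sConst 15 (1 / 2), .sConst 14 (-1 / 4)] with hs1
  have h0 : s1.scal 0 = ε := by simp [hs1, run, Instr.apply, State.setScal, initialState]
  have h15 : s1.scal 15 = 1 / 2 := by simp [hs1, run, Instr.apply, State.setScal]
  by_cases h : ε ≤ 1 / 2
  · refine ⟨_, .seq e1 (.condTrue ?_ (exec_block (l := [.sAdd 17 0 8]) ?_)), ?_⟩
    · simp only [Test.Holds, h0, h15]; exact h
    · simp [LegalRun, Instr.Legal]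
    · rw [hs1]
      constructor <;> simp [run, Instr.apply, State.setScal, initialState]
      simpa using h
  · refine ⟨_, .seq e1 (.condFalse ?_ (exec_block (l := [.sAdd 17 15 8]) ?_)), ?_⟩
    · simp only [Test.Holds, h0, h15]; exact h
    · simp [LegalRun, Instr.Legal]
    · rw [hs1]
      constructor <;> simp [run, Instr.apply, State.setScal, initialState]
      simpa using (not_le.mp h).le

theorem exec_const {P : PositiveSDP n m} {ε : ℝ} {s : State n m} (h : HoldsInput P ε s) :
    Exec (block constInstrs) s 13 (run s constInstrs) ∧ HoldsConst P ε (run s constInstrs) := by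
  refine ⟨exec_block (by simp [LegalRun, constInstrs, Instr.Legal]), ?_⟩
  constructor
  · constructor <;> simp [run, constInstrs, Instr.apply, State.setScal, h.s1, h.s2, h.s8, h.s9,
      h.s11, h.s12, h.s13, h.s14, h.s15, h.s17, h.v0, h.m0, h.m6, h.f0]
  all_goals simp [run, constInstrs, Instr.apply, State.setScal, h.s1, h.s2, h.s9, h.s17, accuracy,
    Iterate.stepSize, Iterate.width]

theorem exec_norm {P : PositiveSDP n m} {ε : ℝ} {s : State n m} (h : HoldsConst P ε s) :
    Exec (block normInstrs) s 17 (run s normInstrs) ∧ HoldsNorm P ε (run s normInstrs) := by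
  refine ⟨exec_block ?_, ?_⟩
  · simp [LegalRun, normInstrs, Instr.Legal, Instr.apply, State.setMat, h.m0, P.C_psd]
  constructor
  · constructor
    · constructor <;> simp [run, normInstrs, Instr.apply, State.setScal, State.setVec,
        State.setMat, State.setFam, h.s1, h.s2, h.s8, h.s9,
        h.s11, h.s12, h.s13, h.s14, h.s15, h.s17, h.v0, h.m0, h.m6, h.f0]
    all_goals simp [run, normInstrs, Instr.apply, State.setScal, State.setVec, State.setMat,
      State.setFam, h.s4, h.s5, h.s6, h.s7]
  · simp [run, normInstrs, Instr.apply, State.setScal, State.setVec, State.setMat, State.setFam,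
      h.v0, h.m0, h.f0, kernelScale, kernelProj, invSqrt]
  · simp [run, normInstrs, Instr.apply, State.setScal, State.setVec, State.setMat, State.setFam,
      h.m0, invSqrt]
  · simp [run, normInstrs, Instr.apply, State.setScal, State.setVec, State.setMat, State.setFam,
      h.m0, kernelProj, invSqrt]
  · simp [run, normInstrs, Instr.apply, State.setScal, State.setVec, State.setMat, State.setFam]
  · simp [run, normInstrs, Instr.apply, State.setScal, State.setVec, State.setMat, State.setFam]
  · funext i
    simp [run, normInstrs, Instr.apply, State.setScal, State.setVec, State.setMat, State.setFam,
      h.s8, h.v0, h.m0, h.f0, normalized, kernelProj, invSqrt]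

theorem exec_start {P : PositiveSDP n m} {ε : ℝ} {s : State n m} (h : HoldsNorm P ε s) :
    Exec (block startInstrs) s 11 (run s startInstrs) ∧
      Holds (P.params ε) (run s startInstrs) (Iterate.start P.normalized) 0 0 := by
  refine ⟨exec_block (by simp [LegalRun, startInstrs, Instr.Legal]), ?_⟩
  constructor <;> simp [run, startInstrs, Instr.apply, State.setScal, State.setVec,
    State.setMat, State.setFam, h.s1, h.s2, h.s4, h.s5, h.s6, h.s7, h.s8, h.s9, h.s11, h.s12,
    h.s13, h.s14, h.s15, h.s16, h.m1, h.m2, h.m3, h.m4, h.m6, h.f1, params, Iterate.start,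
    Iterate.load, Iterate.scaling]

theorem exec_prep (P : PositiveSDP n m) (ε : ℝ) :
    ∃ (s : State n m) (k : ℕ), k ≤ 50 ∧ Exec prepProg (initialState P ε) k s ∧
      Holds (P.params ε) s (Iterate.start P.normalized) 0 0 := by
  obtain ⟨s1, e1, h1⟩ := exec_input P ε
  obtain ⟨e2, h2⟩ := exec_const h1
  obtain ⟨e3, h3⟩ := exec_norm h2
  obtain ⟨e4, h4⟩ := exec_start h3
  exact ⟨_, _, by norm_num, .seq e1 (.seq e2 (.seq e3 e4)), h4⟩

/-! ### Batching steps into iterations -/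

section

variable {F : Fin m → Matrix (Fin n) (Fin n) ℝ} {δ α : ℝ} {w : Iterate n m} {k : ℕ}

theorem flaggedStep_iterate_of_le (hk : ∀ j < k, ¬ ((Iterate.step F δ α)^[j] w).Stop F δ) :
    (flaggedStep F δ α)^[k] (w, 0) = ((Iterate.step F δ α)^[k] w, 0) := by
  induction k with
  | zero => rfl
  | succ k ih =>
    rw [Function.iterate_succ_apply', ih fun j hj => hk j (by omega), flaggedStep,
      if_neg (hk k (by omega)), Function.iterate_succ_apply']

/-- Raising the flag takes one flagged step after the `k` proper ones, hence `k + 1`. Later steps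
change nothing, so a batch may overshoot. -/
theorem flaggedStep_iterate_of_lt (hk : ∀ j < k, ¬ ((Iterate.step F δ α)^[j] w).Stop F δ)
    (hs : ((Iterate.step F δ α)^[k] w).Stop F δ) (l : ℕ) :
    (flaggedStep F δ α)^[k + 1 + l] (w, 0) = ((Iterate.step F δ α)^[k] w, 1) := by
  induction l with
  | zero =>
    rw [add_zero, Function.iterate_succ_apply', flaggedStep_iterate_of_le hk, flaggedStep,
      if_pos hs]
  | succ l ih =>
    rw [← add_assoc, Function.iterate_succ_apply', ih, flaggedStep, if_pos hs]

theorem flaggedStep_iterate_x_nonneg (hα : 0 ≤ α) (hw : ∀ i, 0 ≤ w.x i) (i : Fin m) :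
    0 ≤ ((flaggedStep F δ α)^[k] (w, 0)).1.x i := by
  induction k generalizing i with
  | zero => exact hw i
  | succ k ih =>
    rw [Function.iterate_succ_apply']
    exact flaggedStep_x_nonneg hα ih i

end

/-- The run of the algorithm if the normalized algorithm stops after `k` steps. -/
theorem computes_of_stop (hn : 2 ≤ n) (P : PositiveSDP n m) {ε : ℝ} (hε : 0 < ε) {k : ℕ}
    (hs : ((Iterate.step P.normalized (accuracy ε) (Iterate.stepSize n (accuracy ε)))^[k]
      (Iterate.start P.normalized)).Stop P.normalized (accuracy ε))
    (hk : ∀ j < k, ¬ ((Iterate.step P.normalized (accuracy ε)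
      (Iterate.stepSize n (accuracy ε)))^[j] (Iterate.start P.normalized)).Stop P.normalized
        (accuracy ε)) :
    approxAlgorithm.Computes P ε (k / (⌊Real.log m / Real.log n⌋₊ + 1) + 1)
      (50 * (1 + Real.log m / Real.log n)) 50
      (invSqrt P.C * ((Iterate.step P.normalized (accuracy ε)
        (Iterate.stepSize n (accuracy ε)))^[k] (Iterate.start P.normalized)).Y * invSqrt P.C
        + P.kernelScale • kernelProj P.C) := by
  have hδ : 0 < accuracy ε := by
    have : 0 < min ε (1 / 2) := lt_min hε (by norm_num)
    unfold accuracy; positivity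
  have hα := (Iterate.stepSize_pos hn hδ).le
  have hr : 0 ≤ Real.log m / Real.log n :=
    div_nonneg (Real.log_natCast_nonneg m) (Real.log_natCast_nonneg n)
  have hF : ∀ i, (P.normalized i).PosSemidef := normalized_posSemidef
  have hx0 : ∀ i, 0 ≤ (Iterate.start P.normalized).x i := fun i => by
    have := (hF i).trace_nonneg
    simp only [Iterate.start, dot_one_right]
    positivity
  set J := ⌊Real.log m / Real.log n⌋₊ + 1 with hJ
  set w₀ := Iterate.start P.normalized
  set f := flaggedStep P.normalized (accuracy ε) (Iterate.stepSize n (accuracy ε)) with hf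
  let Good : ℕ → State n m → Prop := fun t s =>
    ∃ j, Holds (P.params ε) s (f^[J * t] (w₀, 0)).1 (f^[J * t] (w₀, 0)).2 j
  have hstep : ∀ t s, Good t s → ∃ s', Good (t + 1) s' ∧
      ∃ l : ℕ, (l : ℝ) ≤ 50 * (1 + Real.log m / Real.log n) ∧ Exec bodyProg s l s' := by
    rintro t s ⟨j, h⟩
    obtain ⟨s', l, hl, e, h'⟩ := exec_bodyProg (p := P.params ε)
      (w := f^[J * t] (w₀, 0)) hF hα hr h
      (flaggedStep_iterate_x_nonneg hα hx0)
    refine ⟨s', ⟨(⌊Real.log m / Real.log n⌋₊ + 1 : ℕ), ?_⟩, l, hl, e⟩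
    · have e1 : f^[J * (t + 1)] (w₀, 0) = f^[J] (f^[J * t] (w₀, 0)) := by
        rw [← Function.iterate_add_apply]; congr 1; ring
      rw [e1]
      exact h'
  choose! next hnext using hstep
  obtain ⟨s₀, k₀, hk₀, e₀, h₀⟩ := exec_prep P ε
  let σ : ℕ → State n m := fun t => Nat.rec s₀ (fun t s => next t s) t
  have hσ : ∀ t, Good t (σ t) := fun t => by
    induction t with
    | zero => exact ⟨0, h₀⟩
    | succ t ih => exact (hnext t _ ih).1
  -- Before these iterations at most `k` flagged steps have been made, so the flag is still down; `J
  -- * (k / J + 1) > k` raises it afterwards.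
  have hguard0 : ∀ t < k / J + 1, approxAlgorithm.guard.Holds (σ t) := fun t ht => by
    obtain ⟨j, h⟩ := hσ t
    have hle : J * t ≤ k :=
      (Nat.mul_le_mul_left J (by omega : t ≤ k / J)).trans (Nat.mul_div_le k J)
    rw [hf, flaggedStep_iterate_of_le fun j hj => hk j (by omega)] at h
    simp only [approxAlgorithm, Test.Holds, h.s12, h.s8, le_refl]
  have hfinal : f^[J * (k / J + 1)] (w₀, 0) = ((Iterate.step P.normalized (accuracy ε)
      (Iterate.stepSize n (accuracy ε)))^[k] w₀, 1) := by
    obtain ⟨l, hl⟩ := Nat.exists_eq_add_of_lt (Nat.lt_mul_div_succ k (by omega : 0 < J))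
    rw [hl, add_right_comm]
    exact flaggedStep_iterate_of_lt hk hs l
  obtain ⟨j, hend⟩ := hσ (k / J + 1)
  rw [hfinal] at hend
  obtain ⟨s', e', hs'⟩ := exec_finish hend
  refine ⟨σ, s', ⟨k₀, by exact_mod_cast hk₀, e₀⟩,
    fun t ht => ⟨hguard0 t ht, (hnext t _ (hσ t)).2⟩, ?_, ⟨4, by norm_num, e'⟩, hs'⟩
  simp only [approxAlgorithm, Test.Holds, hend.s12, hend.s8]
  norm_num

end

end PSDP

/-! ### The main theorem -/

theorem mainTheorem1 :
    ∃ (approxPSDP : PSDP.Algorithm) (c : ℝ),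
      ∀ (n m : ℕ), 2 ≤ n →
      ∀ (P : PSDP.PositiveSDP n m), (∃ Y, P.IsFeasible Y) →
      ∀ ε : ℝ, 0 < ε →
        ∃ (T : ℕ) (Y : Matrix (Fin n) (Fin n) ℝ),
          approxPSDP.Computes P ε T (c * (1 + Real.log m / Real.log n)) c Y ∧
          P.IsApprox ε Y ∧
          (T : ℝ) ≤ c * ((1 / min ε (1 / 2)) ^ 4 * Real.log n ^ 4 *
            Real.log (1 / min ε (1 / 2))) := by
  refine ⟨PSDP.approxAlgorithm, 20000000, fun n m hn P hfeas ε hε => ?_⟩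
  have he : 0 < min ε (1 / 2) := lt_min hε (by norm_num)
  have he' : min ε (1 / 2) ≤ 1 / 2 := min_le_right _ _
  have heε : min ε (1 / 2) ≤ ε := min_le_left _ _
  have hδ : 0 < PSDP.PositiveSDP.accuracy ε := by unfold PSDP.PositiveSDP.accuracy; positivity
  have hδ' : PSDP.PositiveSDP.accuracy ε ≤ 1 / 12 := by
    unfold PSDP.PositiveSDP.accuracy; linarith
  obtain ⟨k, hs, hk, hbound, hcov, hopt⟩ :=
    PSDP.Iterate.exists_stop (F := P.normalized) PSDP.PositiveSDP.normalized_posSemidef hn hδ hδ'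
  have hr : 0 ≤ Real.log m / Real.log n :=
    div_nonneg (Real.log_natCast_nonneg m) (Real.log_natCast_nonneg n)
  obtain ⟨σ, final, ⟨k₀, hk₀, e₀⟩, hbody, hguard, ⟨k₁, hk₁, e₁⟩, hY⟩ :=
    PSDP.computes_of_stop hn P hε hs hk
  refine ⟨_, _, ⟨σ, final, ⟨k₀, by linarith, e₀⟩, fun t ht => ?_, hguard, ⟨k₁, by linarith, e₁⟩,
    hY⟩, ?_, ?_⟩
  · obtain ⟨hg, l, hl, e⟩ := hbody t ht
    exact ⟨hg, l, by linarith, e⟩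
  · refine PSDP.PositiveSDP.isApprox_of_covers hfeas (by positivity) ?_ hcov hopt
    -- With `δ ≤ 1/12`, `(1 + δ) (1 + 4δ) ≤ 1 + 6δ ≤ 1 + ε`; hence the divisor `6`.
    have : PSDP.PositiveSDP.accuracy ε = min ε (1 / 2) / 6 := rfl
    nlinarith
  · have h1 := PSDP.one_le_iterationBound hn he he'
    set X := (1 / min ε (1 / 2)) ^ 4 * Real.log n ^ 4 * Real.log (1 / min ε (1 / 2))
    set r := Real.log m / Real.log n with hrdef
    rcases hbound with rfl | ⟨hm, hkb⟩
    · simp only [Nat.zero_div, zero_add, Nat.cast_one]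
      linarith
    · have h2 := hkb.trans (PSDP.stepBound_le hn hm he he')
      rw [← hrdef] at h2
      have h3 : (((k / (⌊r⌋₊ + 1) : ℕ)) : ℝ) ≤ k / ((⌊r⌋₊ + 1 : ℕ) : ℝ) := Nat.cast_div_le
      -- The batch size is at least half of the factor `1 + r` in the step bound, so division by it
      -- cancels the dependence on `m`.
      have h4 : (1 + r) / 2 ≤ ((⌊r⌋₊ + 1 : ℕ) : ℝ) := by
        have := Nat.lt_floor_add_one r
        push_cast
        have : (0 : ℝ) ≤ ⌊r⌋₊ := Nat.cast_nonneg _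
        linarith
      have h5 : (k : ℝ) / ((⌊r⌋₊ + 1 : ℕ) : ℝ) ≤ 14000000 * X := by
        rw [div_le_iff₀ (by positivity)]
        have := mul_le_mul_of_nonneg_left h4 (by linarith : 0 ≤ 14000000 * X)
        linarith
      push_cast at h3 h5 ⊢
      linarith
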